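/- Let $f:\mathbb R^N\to\mathbb R\cup\{\infty\}$ be a standard self-concordant function: $f$ is closed and convex with open domain, is three times continuously differentiable on $\operatorname{dom} f$, and $|\psi'''(0)|\le 2\,\psi''(0)^{3/2}$ for $\psi(t)=f(x+tu)$, for all $x\in\operatorname{dom} f$ and $u\in\mathbb R^N$. Let $g:\mathbb R^N\to\mathbb R\cup\{\infty\}$ be proper, closed and convex, and put $F=f+g$, $F^*=\inf F$. Assume that $\nabla^2 f(x)$ is positive definite for every $x\in\operatorname{dom} F$ and that $F$ has a unique minimizer. Write $$\|u\|_x=\sqrt{\langle u,\nabla^2 f(x)u\rangle},\qquad \|v\|_x^*=\sqrt{\langle v,(\nabla^2 f(x))^{-1}v\rangle},$$ $$\tilde d(x)=\arg\min_d\Big\{f(x)+\langle\nabla f(x),d\rangle+\tfrac12\langle d,\nabla^2 f(x)d\rangle+g(x+d)\Big\},\qquad \tilde\lambda(x)=\|\tilde d(x)\|_x,\qquad \bar\lambda(x)=\min_{s\in\partial F(x)}\|s\|_x^*$$ (with $\bar\lambda(x)=\infty$ if $\partial F(x)=\emptyset$), and $$\omega(t)=t-\ln(1+t),\qquad \omega_*(t)=-t-\ln(1-t),$$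 with $\omega_*^{-1}:[0,\infty)\to[0,1)$ the inverse of $\omega_*|_{[0,1)}$. Let $x^0\in\operatorname{dom}F$, $\mathcal S(x^0)=\{x:F(x)\le F(x^0)\}$, $\delta_0=F(x^0)-F^*$, $\sigma_f=\min_{x\in\mathcal S(x^0)}\lambda_{\min}(\nabla^2 f(x))$. Suppose that for some $c_3>0$ $$\|\tilde d(x)\|\ge c_3\,\bar\lambda(x)\qquad\text{for all }x\in\mathcal S(x^0),$$ and put $\hat c=c_3\sqrt{\sigma_f}$. Consider the two-stage proximal Newton method started at $x^0$: it takes damped steps $x^{k+1}=x^k+\tilde d(x^k)/(1+\tilde\lambda(x^k))$ until an iterate satisfies $\tilde\lambda(x^k)\le 0.2$, and from that iterate on takes full steps $x^{k+1}=x^k+\tilde d(x^k)$. **Theorem.** For every tolerance $\epsilon$ with $0<\epsilon<0.28\,\exp(-e^{2/3})$ $(\approx 0.0399)$, the method is well defined up to, and finds, some iterate $x^k\in\operatorname{dom}F$ with $\tilde\lambda(x^k)\le\epsilon$ after at most $$\min\left\{\left\lceil\left[\frac{\log\omega(0.2)-\log\delta_0}{\log\left(1-\frac{\hat c^2(1-\omega_*^{-1}(\delta_0))}{1+\hat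 c\,\omega_*^{-1}(\delta_0)}\right)}\right]_+\right\rceil,\ \left\lceil\frac{\delta_0}{\omega(0.2)}\right\rceil\right\}+\left\lceil 1.5\log\log\frac{0.28}{\epsilon}\right\rceil$$ iterations, where $t_+=\max(t,0)$, $\log=\ln$, and the minimum is read as $0$ if $\delta_0=0$. -/

import Mathlib

namespace CompositeSC

noncomputable section

/-- The Euclidean space of dimension `N`. -/
abbrev Vec (N : ℕ) : Type := EuclideanSpace ℝ (Fin N)

/-- The effective domain of an extended-real-valued function. -/
def dom {N : ℕ} (h : Vec N → EReal) : Set (Vec N) := {x | h x < ⊤}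

/-- A closed convex function with values in `ℝ ∪ {∞}`: the value `-∞` is not taken, the epigraph
is convex, and the function is lower semicontinuous (equivalently, the epigraph is closed). -/
structure IsClosedConvex {N : ℕ} (h : Vec N → EReal) : Prop where
  ne_bot : ∀ x, h x ≠ ⊥
  convex_epigraph : Convex ℝ {p : Vec N × ℝ | h p.1 ≤ (p.2 : EReal)}
  lsc : LowerSemicontinuous h

/-- A proper closed convex function. -/
structure IsProperClosedConvex {N : ℕ} (h : Vec N → EReal) : Prop extends IsClosedConvex h where
  proper : (dom h).Nonempty

/-- A self-concordant function with parameter `M`: closed convex, with open domain, three times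
continuously differentiable on its domain, and `|ψ'''(0)| ≤ M ψ''(0)^(3/2)` for
`ψ(t) = f(x + t u)`, for every `x` in the domain and every direction `u`. -/
structure IsSelfConcordant {N : ℕ} (M : ℝ) (f : Vec N → EReal) : Prop extends
    IsClosedConvex f where
  isOpen_dom : IsOpen (dom f)
  contDiffOn : ContDiffOn ℝ 3 (fun x => (f x).toReal) (dom f)
  third_le : ∀ x ∈ dom f, ∀ u : Vec N,
    |iteratedDeriv 3 (fun t : ℝ => (f (x + t • u)).toReal) 0| ≤
      M * (iteratedDeriv 2 (fun t : ℝ => (f (x + t • u)).toReal) 0) ^ (3 / 2 : ℝ)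

/-- A standard self-concordant function: the parameter is `2`. -/
def IsStandardSelfConcordant {N : ℕ} (f : Vec N → EReal) : Prop := IsSelfConcordant 2 f

/-- The gradient `∇f(x)`; used only on the (open) domain of `f`. -/
def grad {N : ℕ} (f : Vec N → EReal) (x : Vec N) : Vec N :=
  gradient (fun y => (f y).toReal) x

/-- The Hessian `∇²f(x)` as a linear operator: the derivative of the gradient. -/
def hess {N : ℕ} (f : Vec N → EReal) (x : Vec N) : Vec N →L[ℝ] Vec N :=
  fderiv ℝ (grad f) x

/-- The local norm `‖u‖_x = √⟨u, ∇²f(x) u⟩`. -/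
def localNorm {N : ℕ} (f : Vec N → EReal) (x u : Vec N) : ℝ :=
  √(inner ℝ u (hess f x u))

/-- The dual local norm `‖v‖*_x = √⟨v, (∇²f(x))⁻¹ v⟩`. -/
def dualLocalNorm {N : ℕ} (f : Vec N → EReal) (x v : Vec N) : ℝ :=
  √(inner ℝ v ((hess f x).inverse v))

/-- The convex subdifferential of an extended-real-valued function. -/
def subdiff {N : ℕ} (h : Vec N → EReal) (x : Vec N) : Set (Vec N) :=
  {s | ∀ y, h x + ((inner ℝ s (y - x) : ℝ) : EReal) ≤ h y}

/-- `λ̄(x) = min {‖s‖*_x : s ∈ ∂F(x)}` with `F = f + g`; it is `∞` when `∂F(x)` is empty. -/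
def lambdaBar {N : ℕ} (f g : Vec N → EReal) (x : Vec N) : ENNReal :=
  ⨅ s ∈ subdiff (f + g) x, ENNReal.ofReal (dualLocalNorm f x s)

/-- The second-order model
`d ↦ f(x) + ⟨∇f(x), d⟩ + ½ ⟨d, ∇²f(x) d⟩ + g(x + d)`. -/
def model {N : ℕ} (f g : Vec N → EReal) (x d : Vec N) : EReal :=
  f x + ((inner ℝ (grad f x) d + 1 / 2 * inner ℝ d (hess f x d) : ℝ) : EReal) + g (x + d)

/-- `d` is a proximal Newton direction at `x`: a global minimizer of the model. -/
def IsProxNewtonDir {N : ℕ} (f g : Vec N → EReal) (x d : Vec N) : Prop :=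
  IsMinOn (model f g x) Set.univ d

/-- The proximal Newton direction `d̃(x) = argmin_d model(d)`. -/
def proxDir {N : ℕ} (f g : Vec N → EReal) (x : Vec N) : Vec N :=
  Classical.epsilon (IsProxNewtonDir f g x)

/-- `λ̃(x) = ‖d̃(x)‖_x`. -/
def proxLambda {N : ℕ} (f g : Vec N → EReal) (x : Vec N) : ℝ :=
  localNorm f x (proxDir f g x)

/-- The level set `{x : F(x) ≤ F(x⁰)}`, with `F = f + g`. -/
def levelSet {N : ℕ} (f g : Vec N → EReal) (x0 : Vec N) : Set (Vec N) :=
  {x | (f + g) x ≤ (f + g) x0}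

/-- The minimal eigenvalue of an operator (used for symmetric operators). -/
def lambdaMin {N : ℕ} (H : Vec N →L[ℝ] Vec N) : ℝ :=
  sInf {μ : ℝ | Module.End.HasEigenvalue (H : Vec N →ₗ[ℝ] Vec N) μ}

/-- `σ_f`, the minimum over the level set of the minimal eigenvalue of the Hessian of `f`. -/
def sigmaF {N : ℕ} (f g : Vec N → EReal) (x0 : Vec N) : ℝ :=
  sInf ((fun x => lambdaMin (hess f x)) '' levelSet f g x0)

/-- `ω(t) = t - ln(1 + t)`. -/
def omega (t : ℝ) : ℝ := t - Real.log (1 + t)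

/-- `ω_*(t) = -t - ln(1 - t)`. -/
def omegaStar (t : ℝ) : ℝ := -t - Real.log (1 - t)

/-- The inverse of `ω_*` restricted to `[0, 1)`. -/
def omegaStarInv (s : ℝ) : ℝ := Function.invFunOn omegaStar (Set.Ico 0 1) s

/-- The initial optimality gap `δ₀ = F(x⁰) - F^*`, where `F = f + g` and `F^* = inf F`. -/
def gap {N : ℕ} (f g : Vec N → EReal) (x0 : Vec N) : ℝ :=
  ((f + g) x0).toReal - (⨅ x, (f + g) x).toReal

/-- The iterates of the two-stage proximal Newton method started at `x0`: damped steps until some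
iterate satisfies `λ̃ ≤ 0.2`, and from that iterate on full steps. -/
structure IsProxNewtonRun {N : ℕ} (f g : Vec N → EReal) (x0 : Vec N) (x : ℕ → Vec N) :
    Prop where
  init : x 0 = x0
  damped_step : ∀ k, (∀ j ≤ k, 0.2 < proxLambda f g (x j)) →
    x (k + 1) = x k + (1 / (1 + proxLambda f g (x k))) • proxDir f g (x k)
  full_step : ∀ k, (∃ j ≤ k, proxLambda f g (x j) ≤ 0.2) →
    x (k + 1) = x k + proxDir f g (x k)

/-- The contraction factor `1 - c² (1 - ω_*⁻¹(δ)) / (1 + c ω_*⁻¹(δ))`. -/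
def contraction (c δ : ℝ) : ℝ :=
  1 - c ^ 2 * (1 - omegaStarInv δ) / (1 + c * omegaStarInv δ)

/-- The iteration bound
`min {⌈[(log ω(0.2) - log δ) / log(contraction)]₊⌉, ⌈δ / ω(0.2)⌉} + ⌈1.5 log log (0.28 / ε)⌉`. -/
def iterationBound (c δ ε : ℝ) : ℕ :=
  min ⌈max ((Real.log (omega 0.2) - Real.log δ) / Real.log (contraction c δ)) 0⌉₊
      ⌈δ / omega 0.2⌉₊
    + ⌈1.5 * Real.log (Real.log (0.28 / ε))⌉₊

end

end CompositeSC

namespace CompositeSC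

open Set

/-! ### The functions `ω` and `ω_*` -/

/-! Write `F = f + g`, and at an iterate write `λ` for the decrement and `d` for the proximal Newton
direction. Self-concordance says that, along a line, the second derivative `h` satisfies `|h'| ≤ 2
h^(3/2)`, so `h^(-1/2)` is `1`-Lipschitz. Integrating twice bounds `f` below and above by its
linearization plus `ω` or `ω_*` of the local distance. Positive definiteness is available only on
`dom F`, so these arguments stay on segments inside `dom f ∩ dom g`.

Damped phase. Optimality of `d` and the upper bound give a decrease of at least `ω(λ)`
(`damped_step`). While `λ > 0.2` each step gains more than `ω(0.2)`, which yields the count `⌈δ₀ /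
ω(0.2)⌉`. For the logarithmic count, the lower bound and Fenchel–Young give `F(x) - F^* ≤ ω_*(λ̄)`,
hence `λ̄ ≥ w := ω_*⁻¹(F(x) - F^*)`. The error bound and `σ_f` give `λ ≥ ĉ w`. On `[0, ω_*⁻¹(δ₀)]`
the function `ω(ĉ ·)` dominates a fixed multiple of `ω_*` (`ratio_mul_omegaStar_le_omega`), so each
step removes a fixed fraction of the gap. A gap of at most `ω(0.2)` is incompatible with `λ > 0.2`,
since one more step would go below the minimum.

Full phase. Optimality of `d` makes `∇f(x+d) - ∇f(x) - ∇²f(x) d` a subgradient of `F` at `x + d`.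
Its dual norm there is at most `(λ/(1-λ))²` (`abs_gradient_error_le`), and the decrement never
exceeds the dual norm of a subgradient, so convergence is quadratic. The error estimate needs the
mixed values `D³f[u,u,v]`, while the definition controls only the diagonal; `abs_trilinear_le`
polarizes without loss of constant. -/

theorem hasDerivAt_omega_mul (r t : ℝ) (h : 0 < 1 + r * t) :
    HasDerivAt (fun t => omega (r * t)) (r ^ 2 * t / (1 + r * t)) t := by
  have h1 : HasDerivAt (fun t : ℝ => r * t) r t := by simpa using (hasDerivAt_id t).const_mul r
  have h2 := h1.sub ((h1.const_add 1).log h.ne')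
  refine h2.congr_deriv ?_
  field_simp
  ring

theorem hasDerivAt_omegaStar_mul (r t : ℝ) (h : 0 < 1 - r * t) :
    HasDerivAt (fun t => omegaStar (r * t)) (r ^ 2 * t / (1 - r * t)) t := by
  have h1 : HasDerivAt (fun t : ℝ => r * t) r t := by simpa using (hasDerivAt_id t).const_mul r
  have h2 := h1.neg.sub ((h1.const_sub 1).log h.ne')
  refine h2.congr_deriv ?_
  field_simp
  ring

theorem hasDerivAt_deriv_omega_mul (r t : ℝ) (h : 0 < 1 + r * t) :
    HasDerivAt (fun t => r ^ 2 * t / (1 + r * t)) (r ^ 2 / (1 + r * t) ^ 2) t := by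
  have h1 : HasDerivAt (fun t : ℝ => r * t) r t := by simpa using (hasDerivAt_id t).const_mul r
  have h3 : HasDerivAt (fun t : ℝ => r ^ 2 * t) (r ^ 2) t := by
    simpa using (hasDerivAt_id t).const_mul (r ^ 2)
  refine (h3.div (h1.const_add 1) h.ne').congr_deriv ?_
  congr 1
  ring

theorem hasDerivAt_deriv_omegaStar_mul (r t : ℝ) (h : 0 < 1 - r * t) :
    HasDerivAt (fun t => r ^ 2 * t / (1 - r * t)) (r ^ 2 / (1 - r * t) ^ 2) t := by
  have h1 : HasDerivAt (fun t : ℝ => r * t) r t := by simpa using (hasDerivAt_id t).const_mul r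
  have h3 : HasDerivAt (fun t : ℝ => r ^ 2 * t) (r ^ 2) t := by
    simpa using (hasDerivAt_id t).const_mul (r ^ 2)
  refine (h3.div (h1.const_sub 1) h.ne').congr_deriv ?_
  congr 1
  ring

theorem omega_zero : omega 0 = 0 := by simp [omega]

theorem omegaStar_zero : omegaStar 0 = 0 := by simp [omegaStar]

theorem hasDerivAt_omega (t : ℝ) (h : 0 < 1 + t) : HasDerivAt omega (t / (1 + t)) t := by
  simpa using hasDerivAt_omega_mul 1 t (by simpa using h)

theorem hasDerivAt_omegaStar (t : ℝ) (h : t < 1) : HasDerivAt omegaStar (t / (1 - t)) t := by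
  simpa using hasDerivAt_omegaStar_mul 1 t (by simpa using h)

theorem omega_strictMonoOn : StrictMonoOn omega (Ici 0) := by
  refine strictMonoOn_of_hasDerivWithinAt_pos (f' := fun t => t / (1 + t)) (convex_Ici 0) ?_ ?_ ?_
  · intro t ht
    exact (hasDerivAt_omega t (by linarith [mem_Ici.1 ht])).continuousAt.continuousWithinAt
  · intro t ht
    rw [interior_Ici] at ht
    exact (hasDerivAt_omega t (by linarith [mem_Ioi.1 ht])).hasDerivWithinAt
  · intro t ht
    rw [interior_Ici] at ht
    have : 0 < t := ht
    positivity

theorem omegaStar_continuousOn : ContinuousOn omegaStar (Ico 0 1) := fun t ht =>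
  (hasDerivAt_omegaStar t ht.2).continuousAt.continuousWithinAt

theorem omegaStar_strictMonoOn : StrictMonoOn omegaStar (Ico 0 1) := by
  refine strictMonoOn_of_hasDerivWithinAt_pos (f' := fun t => t / (1 - t)) (convex_Ico 0 1)
    omegaStar_continuousOn ?_ ?_
  · intro t ht
    rw [interior_Ico] at ht
    exact (hasDerivAt_omegaStar t ht.2).hasDerivWithinAt
  · intro t ht
    rw [interior_Ico] at ht
    exact div_pos ht.1 (by linarith [ht.2])

theorem omega_pos {t : ℝ} (ht : 0 < t) : 0 < omega t := by
  simpa [omega_zero] using omega_strictMonoOn (mem_Ici.2 le_rfl) (mem_Ici.2 ht.le) ht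

theorem omega_nonneg {t : ℝ} (ht : 0 ≤ t) : 0 ≤ omega t := by
  simpa [omega_zero] using omega_strictMonoOn.monotoneOn (mem_Ici.2 le_rfl) (mem_Ici.2 ht) ht

theorem exists_omegaStar_eq {s : ℝ} (hs : 0 ≤ s) : ∃ t ∈ Ico (0 : ℝ) 1, omegaStar t = s := by
  -- Chosen so that `-log (1 - b) = s + 1`; since `b < 1`, the value `ω_*(b) = s + 1 - b` exceeds
  -- `s`.
  set b := 1 - Real.exp (-(s + 1)) with hb
  have he : 0 < Real.exp (-(s + 1)) := Real.exp_pos _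
  have he1 : Real.exp (-(s + 1)) ≤ 1 := Real.exp_le_one_iff.2 (by linarith)
  have hb0 : 0 ≤ b := by linarith
  have hb1 : b < 1 := by linarith
  have hv : s ≤ omegaStar b := by
    have : 1 - b = Real.exp (-(s + 1)) := by rw [hb]; ring
    rw [omegaStar, this, Real.log_exp]
    linarith
  obtain ⟨t, ht, hts⟩ := intermediate_value_Icc hb0
    (omegaStar_continuousOn.mono fun t ht => ⟨ht.1, ht.2.trans_lt hb1⟩)
    (show s ∈ Icc (omegaStar 0) (omegaStar b) from ⟨by rwa [omegaStar_zero], hv⟩)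
  exact ⟨t, ⟨ht.1, ht.2.trans_lt hb1⟩, hts⟩

theorem omegaStarInv_mem {s : ℝ} (hs : 0 ≤ s) : omegaStarInv s ∈ Ico (0 : ℝ) 1 :=
  Function.invFunOn_mem (exists_omegaStar_eq hs)

theorem omegaStar_omegaStarInv {s : ℝ} (hs : 0 ≤ s) : omegaStar (omegaStarInv s) = s :=
  Function.invFunOn_eq (exists_omegaStar_eq hs)

theorem omegaStarInv_mono {s t : ℝ} (hs : 0 ≤ s) (hst : s ≤ t) :
    omegaStarInv s ≤ omegaStarInv t := by
  have ht := hs.trans hst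
  rw [← omegaStar_strictMonoOn.le_iff_le (omegaStarInv_mem hs) (omegaStarInv_mem ht),
    omegaStar_omegaStarInv hs, omegaStar_omegaStarInv ht]
  exact hst

/-- The Fenchel–Young inequality for the conjugate pair `ω`, `ω_*`. -/
theorem mul_le_omega_add_omegaStar {a r : ℝ} (ha1 : a < 1) (hr : 0 ≤ r) :
    a * r ≤ omega r + omegaStar a := by
  have h1 : 0 < 1 + r := by linarith
  have h2 : 0 < 1 - a := by linarith
  have h := Real.log_le_sub_one_of_pos (mul_pos h1 h2)
  rw [Real.log_mul h1.ne' h2.ne'] at h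
  simp only [omega, omegaStar]
  nlinarith

theorem omegaStar_div_one_add {l : ℝ} (hl : 0 ≤ l) :
    omegaStar (l / (1 + l)) = Real.log (1 + l) - l / (1 + l) := by
  have h1 : 0 < 1 + l := by linarith
  have : 1 - l / (1 + l) = (1 + l)⁻¹ := by field_simp; ring
  rw [omegaStar, this, Real.log_inv]
  ring

/-- The derivatives of `ω(c ·)` and `ω_*` have quotient `c² (1 - s) / (1 + c s)`, which decreases in
`s`. Its value at `w` is therefore a lower bound on all of `[0, w]`, and both functions vanish at
`0`. This is the source of the contraction factor. -/
theorem ratio_mul_omegaStar_le_omega {c t w : ℝ} (hc : 0 ≤ c) (ht : 0 ≤ t) (htw : t ≤ w)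
    (hw : w < 1) :
    c ^ 2 * (1 - w) / (1 + c * w) * omegaStar t ≤ omega (c * t) := by
  set ρ := c ^ 2 * (1 - w) / (1 + c * w) with hρ
  have hder : ∀ s ∈ Icc 0 w, HasDerivAt (fun s => omega (c * s) - ρ * omegaStar s)
      (c ^ 2 * s / (1 + c * s) - ρ * (s / (1 - s))) s := fun s hs =>
    (hasDerivAt_omega_mul c s (by have := mul_nonneg hc hs.1; linarith)).sub
      ((hasDerivAt_omegaStar s (hs.2.trans_lt hw)).const_mul ρ)
  have hmono : MonotoneOn (fun s => omega (c * s) - ρ * omegaStar s) (Icc 0 w) := by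
    refine monotoneOn_of_hasDerivWithinAt_nonneg (convex_Icc 0 w)
      (fun s hs => (hder s hs).continuousAt.continuousWithinAt)
      (fun s hs => (hder s (interior_subset hs)).hasDerivWithinAt) ?_
    intro s hs
    obtain ⟨hs0, hsw⟩ := interior_subset hs
    have h1 : 0 < 1 - s := by linarith
    have h2 : 0 < 1 + c * s := by have := mul_nonneg hc hs0; linarith
    have h3 : 0 < 1 + c * w := by have := mul_nonneg hc (hs0.trans hsw); linarith
    have hle : ρ ≤ c ^ 2 * (1 - s) / (1 + c * s) := by
      rw [hρ]
      gcongr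
    have : ρ * (s / (1 - s)) ≤ c ^ 2 * (1 - s) / (1 + c * s) * (s / (1 - s)) := by
      gcongr
    have e : c ^ 2 * (1 - s) / (1 + c * s) * (s / (1 - s)) = c ^ 2 * s / (1 + c * s) := by
      field_simp
    linarith
  have := hmono ⟨le_rfl, ht.trans htw⟩ ⟨ht, htw⟩ ht
  simp only [mul_zero, omega_zero, omegaStar_zero, sub_zero] at this
  linarith

/-! ### Second-order comparison and self-concordance on an interval -/

theorem le_of_second_deriv_le {a a1 a2 b b1 b2 : ℝ → ℝ} {T : ℝ} (hT : 0 ≤ T)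
    (ha : ∀ t ∈ Icc 0 T, HasDerivAt a (a1 t) t) (ha1 : ∀ t ∈ Icc 0 T, HasDerivAt a1 (a2 t) t)
    (hb : ∀ t ∈ Icc 0 T, HasDerivAt b (b1 t) t) (hb1 : ∀ t ∈ Icc 0 T, HasDerivAt b1 (b2 t) t)
    (h0 : a 0 = b 0) (h1 : a1 0 = b1 0) (h2 : ∀ t ∈ Icc 0 T, a2 t ≤ b2 t) : a T ≤ b T := by
  have key : ∀ {p p' : ℝ → ℝ}, (∀ t ∈ Icc 0 T, HasDerivAt p (p' t) t) →
      (∀ t ∈ Icc 0 T, 0 ≤ p' t) → p 0 = 0 → ∀ t ∈ Icc 0 T, 0 ≤ p t := by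
    intro p p' hp hp' hp0 t ht
    have hm : MonotoneOn p (Icc 0 T) := monotoneOn_of_hasDerivWithinAt_nonneg (convex_Icc 0 T)
      (fun s hs => (hp s hs).continuousAt.continuousWithinAt)
      (fun s hs => (hp s (interior_subset hs)).hasDerivWithinAt)
      (fun s hs => hp' s (interior_subset hs))
    rw [← hp0]
    exact hm ⟨le_rfl, hT⟩ ht ht.1
  have k1 := key (p := fun t => b1 t - a1 t) (fun t ht => (hb1 t ht).sub (ha1 t ht))
    (fun t ht => sub_nonneg.2 (h2 t ht)) (by simp [h1])
  have k2 := key (p := fun t => b t - a t) (fun t ht => (hb t ht).sub (ha t ht)) k1 (by simp [h0])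
  linarith [k2 T ⟨hT, le_rfl⟩]

/-- Along an interval, `h ^ (-1/2)` is `1`-Lipschitz when `|h'| ≤ 2 h ^ (3/2)`. -/
theorem abs_inv_sqrt_sub_le {h h' : ℝ → ℝ} {T : ℝ} (hT : 0 ≤ T)
    (hd : ∀ t ∈ Icc 0 T, HasDerivAt h (h' t) t) (hpos : ∀ t ∈ Icc 0 T, 0 < h t)
    (hb : ∀ t ∈ Icc 0 T, |h' t| ≤ 2 * h t * √(h t)) : |(√(h T))⁻¹ - (√(h 0))⁻¹| ≤ T := by
  have hder : ∀ t ∈ Icc 0 T, HasDerivWithinAt (fun t => (√(h t))⁻¹)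
      (-(h' t / (2 * √(h t))) / (√(h t)) ^ 2) (Icc 0 T) t := fun t ht =>
    (((hd t ht).sqrt (hpos t ht).ne').inv
      (Real.sqrt_pos.2 (hpos t ht)).ne').hasDerivWithinAt
  have := (convex_Icc 0 T).norm_image_sub_le_of_norm_hasDerivWithin_le (C := 1) hder ?_
    (left_mem_Icc.2 hT) (right_mem_Icc.2 hT)
  · simpa [abs_of_nonneg hT] using this
  · intro t ht
    have hp := hpos t ht
    have hs := Real.sqrt_pos.2 hp
    have hsq : (√(h t)) ^ 2 = h t := Real.sq_sqrt hp.le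
    rw [Real.norm_eq_abs, abs_div, abs_neg, abs_div, abs_of_pos (by positivity : 0 < 2 * √(h t)),
      abs_of_pos (by positivity : 0 < √(h t) ^ 2), div_div, div_le_one (by positivity), hsq]
    linarith [hb t ht]

theorem le_div_of_selfConcordant {h h' : ℝ → ℝ} {T r : ℝ} (hT : 0 ≤ T)
    (hd : ∀ t ∈ Icc 0 T, HasDerivAt h (h' t) t) (hpos : ∀ t ∈ Icc 0 T, 0 < h t)
    (hb : ∀ t ∈ Icc 0 T, |h' t| ≤ 2 * h t * √(h t)) (hr : 0 < r) (hr2 : h 0 = r ^ 2)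
    (hrT : r * T < 1) : h T ≤ r ^ 2 / (1 - r * T) ^ 2 := by
  have h1 := (abs_le.1 (abs_inv_sqrt_sub_le hT hd hpos hb)).1
  rw [hr2, Real.sqrt_sq hr.le] at h1
  have hp := hpos T (right_mem_Icc.2 hT)
  have hs := Real.sqrt_pos.2 hp
  have h3 : 0 < 1 - r * T := by linarith
  have h2 : (1 - r * T) / r ≤ (√(h T))⁻¹ := by
    have : (1 - r * T) / r = r⁻¹ - T := by field_simp
    linarith
  have h4 : √(h T) ≤ r / (1 - r * T) := by
    rw [le_inv_comm₀ (by positivity) hs, inv_div] at h2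
    exact h2
  calc h T = √(h T) ^ 2 := (Real.sq_sqrt hp.le).symm
    _ ≤ (r / (1 - r * T)) ^ 2 := by gcongr
    _ = _ := by rw [div_pow]

theorem div_le_of_selfConcordant {h h' : ℝ → ℝ} {T r : ℝ} (hT : 0 ≤ T)
    (hd : ∀ t ∈ Icc 0 T, HasDerivAt h (h' t) t) (hpos : ∀ t ∈ Icc 0 T, 0 < h t)
    (hb : ∀ t ∈ Icc 0 T, |h' t| ≤ 2 * h t * √(h t)) (hr : 0 < r) (hr2 : h 0 = r ^ 2) :
    r ^ 2 / (1 + r * T) ^ 2 ≤ h T := by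
  have h1 := (abs_le.1 (abs_inv_sqrt_sub_le hT hd hpos hb)).2
  rw [hr2, Real.sqrt_sq hr.le] at h1
  have hp := hpos T (right_mem_Icc.2 hT)
  have hs := Real.sqrt_pos.2 hp
  have h3 : 0 < 1 + r * T := by positivity
  have h2 : (√(h T))⁻¹ ≤ (1 + r * T) / r := by
    have : (1 + r * T) / r = r⁻¹ + T := by field_simp
    linarith
  have h4 : r / (1 + r * T) ≤ √(h T) := by
    rw [inv_le_comm₀ hs (by positivity), inv_div] at h2
    exact h2
  calc r ^ 2 / (1 + r * T) ^ 2 = (r / (1 + r * T)) ^ 2 := by rw [div_pow]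
    _ ≤ √(h T) ^ 2 := by gcongr
    _ = h T := Real.sq_sqrt hp.le

theorem le_add_omegaStar_of_selfConcordant {p p1 h h' : ℝ → ℝ} {T r : ℝ} (hT : 0 ≤ T)
    (hp : ∀ t ∈ Icc 0 T, HasDerivAt p (p1 t) t) (hp1 : ∀ t ∈ Icc 0 T, HasDerivAt p1 (h t) t)
    (hd : ∀ t ∈ Icc 0 T, HasDerivAt h (h' t) t) (hpos : ∀ t ∈ Icc 0 T, 0 < h t)
    (hb : ∀ t ∈ Icc 0 T, |h' t| ≤ 2 * h t * √(h t)) (hr : 0 < r) (hr2 : h 0 = r ^ 2)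
    (hrT : r * T < 1) : p T ≤ p 0 + p1 0 * T + omegaStar (r * T) := by
  have hlt : ∀ t ∈ Icc 0 T, 0 < 1 - r * t := fun t ht => by
    have := mul_le_mul_of_nonneg_left ht.2 hr.le
    linarith
  refine le_of_second_deriv_le (b := fun t => p 0 + p1 0 * t + omegaStar (r * t))
    (b1 := fun t => p1 0 + r ^ 2 * t / (1 - r * t)) (b2 := fun t => r ^ 2 / (1 - r * t) ^ 2)
    hT hp hp1 ?_ ?_ (by simp [omegaStar_zero]) (by simp) ?_
  · intro t ht
    have := (((hasDerivAt_id t).const_mul (p1 0)).const_add (p 0)).add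
      (hasDerivAt_omegaStar_mul r t (hlt t ht))
    exact this.congr_deriv (by simp)
  · intro t ht
    exact (hasDerivAt_deriv_omegaStar_mul r t (hlt t ht)).const_add (p1 0)
  · intro t ht
    have hsub : Icc 0 t ⊆ Icc 0 T := Icc_subset_Icc_right ht.2
    exact le_div_of_selfConcordant ht.1 (fun s hs => hd s (hsub hs)) (fun s hs => hpos s (hsub hs))
      (fun s hs => hb s (hsub hs)) hr hr2 (by linarith [hlt t ht])

theorem add_omega_le_of_selfConcordant {p p1 h h' : ℝ → ℝ} {T r : ℝ} (hT : 0 ≤ T)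
    (hp : ∀ t ∈ Icc 0 T, HasDerivAt p (p1 t) t) (hp1 : ∀ t ∈ Icc 0 T, HasDerivAt p1 (h t) t)
    (hd : ∀ t ∈ Icc 0 T, HasDerivAt h (h' t) t) (hpos : ∀ t ∈ Icc 0 T, 0 < h t)
    (hb : ∀ t ∈ Icc 0 T, |h' t| ≤ 2 * h t * √(h t)) (hr : 0 < r) (hr2 : h 0 = r ^ 2) :
    p 0 + p1 0 * T + omega (r * T) ≤ p T := by
  have hlt : ∀ t ∈ Icc 0 T, 0 < 1 + r * t := fun t ht => by
    have := mul_nonneg hr.le ht.1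
    linarith
  refine le_of_second_deriv_le (a := fun t => p 0 + p1 0 * t + omega (r * t))
    (a1 := fun t => p1 0 + r ^ 2 * t / (1 + r * t)) (a2 := fun t => r ^ 2 / (1 + r * t) ^ 2)
    hT ?_ ?_ hp hp1 (by simp [omega_zero]) (by simp) ?_
  · intro t ht
    have := (((hasDerivAt_id t).const_mul (p1 0)).const_add (p 0)).add
      (hasDerivAt_omega_mul r t (hlt t ht))
    exact this.congr_deriv (by simp)
  · intro t ht
    exact (hasDerivAt_deriv_omega_mul r t (hlt t ht)).const_add (p1 0)
  · intro t ht
    have hsub : Icc 0 t ⊆ Icc 0 T := Icc_subset_Icc_right ht.2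
    exact div_le_of_selfConcordant ht.1 (fun s hs => hd s (hsub hs)) (fun s hs => hpos s (hsub hs))
      (fun s hs => hb s (hsub hs)) hr hr2

/-! ### Quadratic convergence of a scalar sequence -/

theorem div_one_sub_sq_le {l b : ℝ} (h0 : 0 ≤ l) (hl : l ≤ b) (hb : b < 1) :
    (l / (1 - l)) ^ 2 ≤ (b / (1 - b)) ^ 2 := by
  have h1 : 0 < 1 - b := by linarith
  have h2 : 0 < 1 - l := by linarith
  have h3 : 0 ≤ b := h0.trans hl
  gcongr

/-- Squaring doubles the exponent, while the claimed bound only multiplies it by `e^(2/3) < 2`. The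
bound starts at index `2`: after one step only `1/16` is guaranteed, more than `0.28 exp(-e^(2/3))`.
The second clause keeps `1/(1 - l)` under control in the induction. -/
theorem quadratic_decay {l : ℕ → ℝ} (h0 : ∀ k, 0 ≤ l k) (hl0 : l 0 ≤ 0.2)
    (hstep : ∀ k, l k ≤ 0.2 → l (k + 1) ≤ (l k / (1 - l k)) ^ 2) (m : ℕ) :
    l (m + 2) ≤ 0.28 * Real.exp (-Real.exp (2 / 3 * ((m : ℝ) + 2))) ∧ l (m + 2) ≤ 1 / 225 := by
  have he : Real.exp 1 < 2.7182818286 := Real.exp_one_lt_d9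
  induction m with
  | zero =>
    have h1 : l 1 ≤ 0.0625 := (hstep 0 hl0).trans <|
      (div_one_sub_sq_le (h0 0) hl0 (by norm_num)).trans (by norm_num)
    have h2 : l 2 ≤ 1 / 225 := (hstep 1 (h1.trans (by norm_num))).trans <|
      (div_one_sub_sq_le (h0 1) h1 (by norm_num)).trans (by norm_num)
    refine ⟨?_, by simpa using h2⟩
    have h4 : Real.exp (4 / 3) ≤ 4 := by
      have : Real.exp (4 / 3) ^ 3 ≤ 4 ^ 3 := by
        rw [← Real.exp_nat_mul]
        calc Real.exp ((3 : ℕ) * (4 / 3)) = Real.exp 1 ^ 4 := by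
              rw [← Real.exp_nat_mul]; congr 1; norm_num
          _ ≤ 2.7182818286 ^ 4 := by gcongr
          _ ≤ 4 ^ 3 := by norm_num
      exact le_of_pow_le_pow_left₀ (by norm_num) (by norm_num) this
    have h5 : (2.7182818286 ^ 4 : ℝ)⁻¹ ≤ Real.exp (-Real.exp (4 / 3)) := by
      calc (2.7182818286 ^ 4 : ℝ)⁻¹ ≤ (Real.exp 1 ^ 4)⁻¹ := by gcongr
        _ = Real.exp (-4) := by rw [Real.exp_neg, ← Real.exp_nat_mul]; norm_num
        _ ≤ _ := Real.exp_le_exp.2 (by linarith)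
    have e : (2 / 3 * (((0 : ℕ) : ℝ) + 2)) = 4 / 3 := by norm_num
    rw [e]
    have : (1 / 225 : ℝ) ≤ 0.28 * (2.7182818286 ^ 4 : ℝ)⁻¹ := by norm_num
    simp only [zero_add]
    linarith
  | succ m ih =>
    obtain ⟨ih1, ih2⟩ := ih
    have hs := hstep (m + 2) (ih2.trans (by norm_num))
    have hb := hs.trans (div_one_sub_sq_le (h0 _) ih2 (by norm_num))
    have e : m + 1 + 2 = m + 2 + 1 := by ring
    rw [e]
    refine ⟨?_, hb.trans (by norm_num)⟩
    set a := Real.exp (2 / 3 * ((m : ℝ) + 2)) with ha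
    have ha' : Real.exp (2 / 3 * (((m + 1 : ℕ) : ℝ) + 2)) ≤ 2 * a := by
      have : (2 / 3 * (((m + 1 : ℕ) : ℝ) + 2)) = 2 / 3 + 2 / 3 * ((m : ℝ) + 2) := by
        push_cast; ring
      rw [this, Real.exp_add]
      gcongr
      have : Real.exp (2 / 3) ^ 3 ≤ 2 ^ 3 := by
        rw [← Real.exp_nat_mul]
        calc Real.exp ((3 : ℕ) * (2 / 3)) = Real.exp 1 ^ 2 := by
              rw [← Real.exp_nat_mul]; congr 1; norm_num
          _ ≤ 2.7182818286 ^ 2 := by gcongr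
          _ ≤ 2 ^ 3 := by norm_num
      exact le_of_pow_le_pow_left₀ (by norm_num) (by norm_num) this
    -- The crude factor `1.5` suffices because `(0.28 * 1.5)² = 0.1764 ≤ 0.28`.
    have h1 : l (m + 2) / (1 - l (m + 2)) ≤ l (m + 2) * 1.5 := by
      have : 0 < 1 - l (m + 2) := by linarith
      rw [div_le_iff₀ this]
      nlinarith [h0 (m + 2)]
    have h2 : 0 ≤ l (m + 2) / (1 - l (m + 2)) := div_nonneg (h0 _) (by linarith)
    calc l (m + 2 + 1) ≤ (l (m + 2) / (1 - l (m + 2))) ^ 2 := hs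
      _ ≤ (0.28 * Real.exp (-a) * 1.5) ^ 2 := by
          gcongr
          exact h1.trans (by gcongr)
      _ = 0.1764 * Real.exp (-(2 * a)) := by
          have : Real.exp (-(2 * a)) = Real.exp (-a) ^ 2 := by
            rw [← Real.exp_nat_mul]; congr 1; push_cast; ring
          rw [this]; ring
      _ ≤ 0.28 * Real.exp (-(2 * a)) := by gcongr; norm_num
      _ ≤ _ := by gcongr

/-- The iteration count of the quadratically convergent phase. -/
theorem quadratic_decay_le {l : ℕ → ℝ} (h0 : ∀ k, 0 ≤ l k) (hl0 : l 0 ≤ 0.2)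
    (hstep : ∀ k, l k ≤ 0.2 → l (k + 1) ≤ (l k / (1 - l k)) ^ 2) {ε : ℝ} (hε : 0 < ε)
    (hεsmall : ε < 0.28 * Real.exp (-Real.exp (2 / 3))) :
    l ⌈1.5 * Real.log (Real.log (0.28 / ε))⌉₊ ≤ ε := by
  set L := Real.log (Real.log (0.28 / ε)) with hL
  have h1 : Real.exp (2 / 3) < Real.log (0.28 / ε) := by
    rw [Real.lt_log_iff_exp_lt (by positivity), lt_div_iff₀ hε]
    rw [Real.exp_neg, ← div_eq_mul_inv, lt_div_iff₀ (Real.exp_pos _)] at hεsmall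
    linarith
  have hlogpos : 0 < Real.log (0.28 / ε) := (Real.exp_pos _).trans h1
  have h2 : 2 / 3 < L := (Real.lt_log_iff_exp_lt hlogpos).2 h1
  -- The threshold on `ε` is exactly what makes `1.5 L > 1`, so the ceiling reaches the index `2` at
  -- which the decay estimate starts.
  have h3 : 1 < ⌈1.5 * L⌉₊ := Nat.lt_ceil.2 (by push_cast; linarith)
  obtain ⟨m, hm⟩ : ∃ m, ⌈1.5 * L⌉₊ = m + 2 := ⟨⌈1.5 * L⌉₊ - 2, by omega⟩
  have h4 : 1.5 * L ≤ (m : ℝ) + 2 := by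
    have := Nat.le_ceil (1.5 * L)
    rw [hm] at this
    exact_mod_cast this
  rw [hm]
  refine (quadratic_decay h0 hl0 hstep m).1.trans ?_
  have h5 : Real.log (0.28 / ε) ≤ Real.exp (2 / 3 * ((m : ℝ) + 2)) := by
    rw [← Real.exp_log hlogpos, ← hL]
    exact Real.exp_le_exp.2 (by linarith)
  calc 0.28 * Real.exp (-Real.exp (2 / 3 * ((m : ℝ) + 2)))
      ≤ 0.28 * Real.exp (-Real.log (0.28 / ε)) := by gcongr
    _ = ε := by rw [Real.exp_neg, Real.exp_log (by positivity)]; field_simp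

end CompositeSC

namespace CompositeSC

/-! ### Polarization of a cubic form -/

/-- A three-node quadrature for the values `p(u, u, v)` of a binary cubic form. -/
theorem cubic_quadrature {C S s a b c d : ℝ} (hCS : C ^ 2 + S ^ 2 = 1) (hs : s ^ 2 = 3)
    (P : ℝ → ℝ → ℝ)
    (hP : ∀ x y, P x y = a * x ^ 3 + 3 * b * x ^ 2 * y + 3 * c * x * y ^ 2 + d * y ^ 3) :
    (4 * C ^ 2 - 1) ^ 2 / 9 * P C S
      + (4 * (-C / 2 - s / 2 * S) ^ 2 - 1) ^ 2 / 9 * P (-C / 2 - s / 2 * S) (-S / 2 + s / 2 * C)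
      + (4 * (-C / 2 + s / 2 * S) ^ 2 - 1) ^ 2 / 9 * P (-C / 2 + s / 2 * S) (-S / 2 - s / 2 * C)
      = a * (4 * C ^ 3 - 3 * C) + b * (3 * S - 4 * S ^ 3) := by
  simp only [hP]
  have hS : S ^ 2 = 1 - C ^ 2 := by linarith
  grind

theorem cubic_quadrature_weights {C S s : ℝ} (hCS : C ^ 2 + S ^ 2 = 1) (hs : s ^ 2 = 3) :
    (4 * C ^ 2 - 1) ^ 2 / 9 + (4 * (-C / 2 - s / 2 * S) ^ 2 - 1) ^ 2 / 9
      + (4 * (-C / 2 + s / 2 * S) ^ 2 - 1) ^ 2 / 9 = 1 := by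
  have hS : S ^ 2 = 1 - C ^ 2 := by linarith
  grind

/-- The three nodes are the angles `θ` with `3 θ = φ` modulo `2π`, and the weights `(4 cos² θ - 1)²
/ 9` are nonnegative with sum `1`. The polar value is thus a convex combination of values of the
cubic form on the unit circle, and no constant is lost. -/
theorem abs_cubic_polar_le {a b c d M : ℝ}
    (h : ∀ x y : ℝ, x ^ 2 + y ^ 2 = 1 →
      |a * x ^ 3 + 3 * b * x ^ 2 * y + 3 * c * x * y ^ 2 + d * y ^ 3| ≤ M) (φ : ℝ) :
    |a * Real.cos φ + b * Real.sin φ| ≤ M := by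
  set C := Real.cos (φ / 3) with hC
  set S := Real.sin (φ / 3) with hS
  have hCS : C ^ 2 + S ^ 2 = 1 := Real.cos_sq_add_sin_sq _
  have hs : (√3 : ℝ) ^ 2 = 3 := Real.sq_sqrt (by norm_num)
  have h1 : Real.cos φ = 4 * C ^ 3 - 3 * C := by
    rw [← Real.cos_three_mul]; congr 1; ring
  have h2 : Real.sin φ = 3 * S - 4 * S ^ 3 := by
    rw [← Real.sin_three_mul]; congr 1; ring
  have key := cubic_quadrature (a := a) (b := b) (c := c) (d := d) hCS hs
    (fun x y => a * x ^ 3 + 3 * b * x ^ 2 * y + 3 * c * x * y ^ 2 + d * y ^ 3) (fun _ _ => rfl)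
  have hw := cubic_quadrature_weights hCS hs
  rw [h1, h2, ← key]
  have b1 := h C S hCS
  have b2 := h (-C / 2 - √3 / 2 * S) (-S / 2 + √3 / 2 * C)
    (by linear_combination hCS / 4 + hCS * (√3) ^ 2 / 4 + hs / 4)
  have b3 := h (-C / 2 + √3 / 2 * S) (-S / 2 - √3 / 2 * C)
    (by linear_combination hCS / 4 + hCS * (√3) ^ 2 / 4 + hs / 4)
  have mul_bound : ∀ p q : ℝ, |q| ≤ M → |p ^ 2 / 9 * q| ≤ p ^ 2 / 9 * M := fun p q hq => by
    rw [abs_mul, abs_of_nonneg (by positivity : 0 ≤ p ^ 2 / 9)]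
    gcongr
  refine (abs_add_three _ _ _).trans ?_
  refine (add_le_add (add_le_add (mul_bound _ _ b1) (mul_bound _ _ b2)) (mul_bound _ _ b3)).trans ?_
  rw [← add_mul, ← add_mul, hw, one_mul]

section Trilinear

variable {E : Type*} [NormedAddCommGroup E] [NormedSpace ℝ E]

/-- With `B` as inner product, Gram–Schmidt gives `v = cos φ • u + sin φ • e`. On the plane of `u`
and `e` the form `T` is a binary cubic, and `T u u v` is the polar value bounded above. -/
theorem abs_trilinear_le_of_unit {B : E →L[ℝ] E →L[ℝ] ℝ} {T : E →L[ℝ] E →L[ℝ] E →L[ℝ] ℝ}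
    (hBs : ∀ u v, B u v = B v u) (hBp : ∀ u, u ≠ 0 → 0 < B u u)
    (hT1 : ∀ u v w, T u v w = T v u w) (hT2 : ∀ u v w, T u v w = T u w v) {M : ℝ}
    (hT : ∀ u, B u u ≤ 1 → |T u u u| ≤ M) {u v : E} (hu : B u u = 1) (hv : B v v = 1) :
    |T u u v| ≤ M := by
  set k := B u v with hk
  set w := v - k • u with hw
  have hww : B w w = 1 - k ^ 2 := by
    simp only [hw, map_sub, map_smul, sub_apply, smul_apply,
      smul_eq_mul, hu, hv, hBs v u, ← hk]
    ring
  have huw : B u w = 0 := by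
    simp only [hw, map_sub, map_smul, smul_eq_mul, hu, ← hk]
    ring
  have hw0 : 0 ≤ B w w := by
    by_cases h : w = 0
    · simp [h]
    · exact (hBp w h).le
  set σ := √(1 - k ^ 2) with hσ
  have hσ2 : σ ^ 2 = 1 - k ^ 2 := Real.sq_sqrt (by rw [← hww]; exact hw0)
  have hσe : σ • (σ⁻¹ • w) = w := by
    by_cases h : σ = 0
    · have : w = 0 := by
        by_contra hne
        have := hBp w hne
        rw [hww, ← hσ2, h] at this
        norm_num at this
      simp [this]
    · rw [smul_smul, mul_inv_cancel₀ h, one_smul]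
  set e := σ⁻¹ • w with he
  -- Only `≤`: if `v = ± u` then `σ = 0` and `e = 0`, because `0⁻¹ = 0`. For this reason `hT` is
  -- assumed on the whole unit ball of `B`.
  have hee : B e e ≤ 1 := by
    simp only [he, map_smul, smul_apply, smul_eq_mul, hww, ← hσ2]
    by_cases h : σ = 0
    · simp [h]
    · field_simp
      exact le_rfl
  have hue : B u e = 0 := by simp [he, huw]
  have hveq : v = k • u + σ • e := by rw [hσe, hw]; abel
  have hk1 : -1 ≤ k ∧ k ≤ 1 := by
    have : k ^ 2 ≤ 1 := by linarith
    exact abs_le.1 ((sq_le_one_iff_abs_le_one k).1 this)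
  have key := abs_cubic_polar_le (a := T u u u) (b := T u u e) (c := T u e e) (d := T e e e)
    (M := M) ?_ (Real.arccos k)
  · rw [Real.cos_arccos hk1.1 hk1.2, Real.sin_arccos, ← hσ] at key
    rw [hveq, map_add, map_smul, map_smul, smul_eq_mul, smul_eq_mul]
    convert key using 2
    ring
  · intro x y hxy
    have hB : B (x • u + y • e) (x • u + y • e) ≤ 1 := by
      simp only [map_add, map_smul, add_apply, smul_apply,
        smul_eq_mul, hu, hue, hBs e u]
      nlinarith [sq_nonneg y]
    have := hT _ hB
    simp only [map_add, map_smul, add_apply, smul_apply,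
        smul_eq_mul] at this
    rw [hT2 u e u, hT1 e u u, hT2 u e u, hT1 e u e, hT2 e e u, hT1 e u e] at this
    convert this using 2
    ring

/-- A symmetric trilinear form is bounded by the bound of its diagonal. -/
theorem abs_trilinear_le {B : E →L[ℝ] E →L[ℝ] ℝ} {T : E →L[ℝ] E →L[ℝ] E →L[ℝ] ℝ}
    (hBs : ∀ u v, B u v = B v u) (hBp : ∀ u, u ≠ 0 → 0 < B u u)
    (hT1 : ∀ u v w, T u v w = T v u w) (hT2 : ∀ u v w, T u v w = T u w v)
    (hT : ∀ u, |T u u u| ≤ 2 * B u u * √(B u u)) (u v : E) :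
    |T u u v| ≤ 2 * B u u * √(B v v) := by
  by_cases hu : u = 0
  · simp [hu]
  by_cases hv : v = 0
  · simp [hv]
  have hu' := Real.sqrt_pos.2 (hBp u hu)
  have hv' := Real.sqrt_pos.2 (hBp v hv)
  have hu2 : √(B u u) ^ 2 = B u u := Real.sq_sqrt (hBp u hu).le
  have hv2 : √(B v v) ^ 2 = B v v := Real.sq_sqrt (hBp v hv).le
  set α := √(B u u) with hα
  set β := √(B v v) with hβ
  have key := abs_trilinear_le_of_unit (M := 2) (u := α⁻¹ • u) (v := β⁻¹ • v) hBs hBp hT1 hT2 ?_ ?_ ?_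
  · simp only [map_smul, smul_apply, smul_eq_mul, abs_mul,
      abs_of_pos (inv_pos.2 hu'), abs_of_pos (inv_pos.2 hv')] at key
    rw [← hu2]
    field_simp at key
    linarith
  · intro w hw
    have hw0 : 0 ≤ B w w := by
      by_cases h : w = 0
      · simp [h]
      · exact (hBp w h).le
    have h1 : √(B w w) ≤ 1 := Real.sqrt_le_one.2 hw
    have := hT w
    nlinarith [Real.sqrt_nonneg (B w w)]
  · simp only [map_smul, smul_apply, smul_eq_mul, ← hu2]
    field_simp
  · simp only [map_smul, smul_apply, smul_eq_mul, ← hv2]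
    field_simp

end Trilinear

end CompositeSC

namespace CompositeSC

open Set Filter Topology

/-! ### Extended-real-valued convex functions -/

section Convex

variable {N : ℕ}

/-- The real value of an extended-real-valued function. -/
def re (h : Vec N → EReal) (x : Vec N) : ℝ := (h x).toReal

theorem IsClosedConvex.coe_re {h : Vec N → EReal} (hh : IsClosedConvex h) {x : Vec N}
    (hx : x ∈ dom h) : ((re h x : ℝ) : EReal) = h x :=
  EReal.coe_toReal (ne_of_lt hx) (hh.ne_bot x)

theorem mem_dom_of_le {h : Vec N → EReal} {x : Vec N} {a : ℝ} (hx : h x ≤ a) : x ∈ dom h :=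
  hx.trans_lt (EReal.coe_lt_top a)

theorem IsClosedConvex.le_coe_iff {h : Vec N → EReal} (hh : IsClosedConvex h) {x : Vec N} {a : ℝ} :
    h x ≤ a ↔ x ∈ dom h ∧ re h x ≤ a := by
  constructor
  · intro hx
    have hd := mem_dom_of_le hx
    rw [← hh.coe_re hd] at hx
    exact ⟨hd, EReal.coe_le_coe_iff.1 hx⟩
  · rintro ⟨hd, hx⟩
    rw [← hh.coe_re hd]
    exact EReal.coe_le_coe_iff.2 hx

theorem IsClosedConvex.convexOn_re {h : Vec N → EReal} (hh : IsClosedConvex h) :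
    ConvexOn ℝ (dom h) (re h) := by
  have key : ∀ x ∈ dom h, ∀ y ∈ dom h, ∀ a b : ℝ, 0 ≤ a → 0 ≤ b → a + b = 1 →
      h (a • x + b • y) ≤ ((a • re h x + b • re h y : ℝ) : EReal) := by
    intro x hx y hy a b ha hb hab
    exact hh.convex_epigraph (x := (x, re h x)) (by simp [hh.coe_re hx])
      (y := (y, re h y)) (by simp [hh.coe_re hy]) ha hb hab
  exact ⟨fun x hx y hy a b ha hb hab => mem_dom_of_le (key x hx y hy a b ha hb hab),
    fun x hx y hy a b ha hb hab => (hh.le_coe_iff.1 (key x hx y hy a b ha hb hab)).2⟩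

theorem IsClosedConvex.mem_dom_add {f g : Vec N → EReal} (hf : IsClosedConvex f)
    (hg : IsClosedConvex g) {x : Vec N} : x ∈ dom (f + g) ↔ x ∈ dom f ∧ x ∈ dom g := by
  have h1 := hf.ne_bot x
  have h2 := hg.ne_bot x
  simp only [dom, mem_ofPred_eq, Pi.add_apply, lt_top_iff_ne_top]
  exact EReal.add_ne_top_iff_ne_top₂ h1 h2

theorem IsClosedConvex.add_coe {f g : Vec N → EReal} (hf : IsClosedConvex f)
    (hg : IsClosedConvex g) {x : Vec N} (hx : x ∈ dom (f + g)) :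
    (f + g) x = ((re f x + re g x : ℝ) : EReal) := by
  obtain ⟨h1, h2⟩ := (hf.mem_dom_add hg).1 hx
  rw [EReal.coe_add, hf.coe_re h1, hg.coe_re h2, Pi.add_apply]

theorem IsClosedConvex.re_add {f g : Vec N → EReal} (hf : IsClosedConvex f)
    (hg : IsClosedConvex g) {x : Vec N} (hx : x ∈ dom (f + g)) :
    re (f + g) x = re f x + re g x := by
  rw [re, hf.add_coe hg hx, EReal.toReal_coe]

theorem lowerSemicontinuous_add_of_ne_bot {f g : Vec N → EReal} (hf : LowerSemicontinuous f)
    (hg : LowerSemicontinuous g) (hfb : ∀ x, f x ≠ ⊥) (hgb : ∀ x, g x ≠ ⊥) :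
    LowerSemicontinuous (f + g) :=
  hf.add' hg fun x => EReal.continuousAt_add (Or.inr (hgb x)) (Or.inl (hfb x))

theorem IsClosedConvex.add {f g : Vec N → EReal} (hf : IsClosedConvex f)
    (hg : IsClosedConvex g) : IsClosedConvex (f + g) where
  ne_bot x := by
    simp only [Pi.add_apply, Ne, EReal.add_eq_bot_iff, hf.ne_bot x, hg.ne_bot x, or_self,
      not_false_eq_true]
  convex_epigraph := by
    rintro ⟨x, s⟩ hx ⟨y, t⟩ hy a b ha hb hab
    simp only [mem_ofPred_eq, Prod.smul_mk, Prod.mk_add_mk] at hx hy ⊢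
    have hxd := mem_dom_of_le hx
    have hyd := mem_dom_of_le hy
    rw [hf.add_coe hg hxd, EReal.coe_le_coe_iff] at hx
    rw [hf.add_coe hg hyd, EReal.coe_le_coe_iff] at hy
    rw [hf.mem_dom_add hg] at hxd hyd
    have h1 := hf.convexOn_re.2 hxd.1 hyd.1 ha hb hab
    have h2 := hg.convexOn_re.2 hxd.2 hyd.2 ha hb hab
    rw [hf.add_coe hg ((hf.mem_dom_add hg).2 ⟨hf.convexOn_re.1 hxd.1 hyd.1 ha hb hab,
      hg.convexOn_re.1 hxd.2 hyd.2 ha hb hab⟩), EReal.coe_le_coe_iff]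
    simp only [smul_eq_mul] at h1 h2 ⊢
    nlinarith
  lsc := lowerSemicontinuous_add_of_ne_bot hf.lsc hg.lsc hf.ne_bot hg.ne_bot

/-- First-order optimality for the sum of a differentiable and a convex function. -/
theorem first_order_of_isLocalMin_add {E : Type*} [NormedAddCommGroup E] [NormedSpace ℝ E]
    {C : Set E} {φ q : E → ℝ} {q' : E →L[ℝ] ℝ} {p : E} (hφ : ConvexOn ℝ C φ) (hp : p ∈ C)
    (hq : HasFDerivAt q q' p) (hmin : ∀ᶠ y in 𝓝 p, y ∈ C → q p + φ p ≤ q y + φ y) {y : E}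
    (hy : y ∈ C) : 0 ≤ q' (y - p) + (φ y - φ p) := by
  have hline : HasDerivAt (fun t : ℝ => p + t • (y - p)) (y - p) 0 := by
    simpa using ((hasDerivAt_id (0 : ℝ)).smul_const (y - p)).const_add p
  have hq0 : HasFDerivAt q q' (p + (0 : ℝ) • (y - p)) := by simpa using hq
  -- Replacing `φ` on the segment by its chord gives a differentiable majorant that agrees with it
  -- at `t = 0`, so its right derivative there is nonnegative.
  have hA : HasDerivAt (fun t : ℝ => q (p + t • (y - p)) + t * (φ y - φ p))
      (q' (y - p) + (φ y - φ p)) 0 := by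
    have h1 := hq0.comp_hasDerivAt (0 : ℝ) hline
    have h2 := (hasDerivAt_id (0 : ℝ)).mul_const (φ y - φ p)
    exact (h1.add h2).congr_deriv (by simp)
  have hs := (hasDerivAt_iff_tendsto_slope.1 hA).mono_left
    (nhdsWithin_mono (0 : ℝ) (show Ioi (0 : ℝ) ⊆ {0}ᶜ from fun t ht => (mem_Ioi.1 ht).ne'))
  refine ge_of_tendsto hs ?_
  have hcont : Tendsto (fun t : ℝ => p + t • (y - p)) (𝓝[>] 0) (𝓝 p) := by
    have := hline.continuousAt.tendsto
    simp only [zero_smul, add_zero] at this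
    exact this.mono_left nhdsWithin_le_nhds
  have hlt : ∀ᶠ t : ℝ in 𝓝[>] 0, t < 1 :=
    nhdsWithin_le_nhds (Iio_mem_nhds (by norm_num : (0 : ℝ) < 1))
  filter_upwards [hcont.eventually hmin, hlt, self_mem_nhdsWithin] with t ht ht1 ht0
  have ht0' : (0 : ℝ) < t := ht0
  have e : p + t • (y - p) = (1 - t) • p + t • y := by module
  have hmem : p + t • (y - p) ∈ C := by
    rw [e]; exact hφ.1 hp hy (by linarith) ht0'.le (by ring)
  have h1 := ht hmem
  have h2 : φ (p + t • (y - p)) ≤ (1 - t) • φ p + t • φ y := by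
    rw [e]; exact hφ.2 hp hy (by linarith) ht0'.le (by ring)
  rw [slope_def_field]
  refine div_nonneg ?_ (by linarith)
  simp only [smul_eq_mul, zero_smul, add_zero, zero_mul] at h2 ⊢
  nlinarith

/-- A lower semicontinuous function that is large outside a ball attains its minimum. -/
theorem exists_isMinOn_univ_of_coercive {h : Vec N → EReal} (hh : LowerSemicontinuous h)
    {x : Vec N} {R : ℝ} (hR : ∀ y, R < ‖y - x‖ → h x ≤ h y) : ∃ y, IsMinOn h univ y := by
  have hmem : x ∈ Metric.closedBall x (max R 0) := Metric.mem_closedBall_self (le_max_right _ _)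
  obtain ⟨z, hz, hmin⟩ := LowerSemicontinuousOn.exists_isMinOn ⟨x, hmem⟩
    (isCompact_closedBall x (max R 0)) (hh.lowerSemicontinuousOn _)
  refine ⟨z, fun y _ => ?_⟩
  by_cases hy : y ∈ Metric.closedBall x (max R 0)
  · exact hmin hy
  · rw [Metric.mem_closedBall, dist_eq_norm, not_le] at hy
    exact (hmin hmem).trans (hR y ((le_max_left _ _).trans_lt hy))

/-- Convexity along a ray: the value at the point of the ray at distance one. -/
theorem re_radial_le {C : Set (Vec N)} {φ : Vec N → ℝ} (hφ : ConvexOn ℝ C φ) {x y : Vec N}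
    (hx : x ∈ C) (hy : y ∈ C) (hR : 1 < ‖y - x‖) :
    ∃ z ∈ C, ‖z - x‖ = 1 ∧ ‖y - x‖ * (φ z - φ x) ≤ φ y - φ x := by
  set R := ‖y - x‖ with hRdef
  have hR0 : 0 < R := by linarith
  have hR1 : R⁻¹ ≤ 1 := inv_le_one_of_one_le₀ hR.le
  have hRi : 0 ≤ R⁻¹ := by positivity
  refine ⟨(1 - R⁻¹) • x + R⁻¹ • y, hφ.1 hx hy (by linarith) hRi (by ring), ?_, ?_⟩
  · have : (1 - R⁻¹) • x + R⁻¹ • y - x = R⁻¹ • (y - x) := by module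
    rw [this, norm_smul, Real.norm_of_nonneg hRi, ← hRdef, inv_mul_cancel₀ hR0.ne']
  · have h := hφ.2 hx hy (by linarith : 0 ≤ 1 - R⁻¹) hRi (by ring)
    simp only [smul_eq_mul] at h
    have h2 : R * φ ((1 - R⁻¹) • x + R⁻¹ • y) ≤ R * ((1 - R⁻¹) * φ x + R⁻¹ * φ y) :=
      mul_le_mul_of_nonneg_left h hR0.le
    have h3 : R * ((1 - R⁻¹) * φ x + R⁻¹ * φ y) = (R - 1) * φ x + φ y := by
      field_simp
    linarith

/-- A closed convex function decreases at most linearly. -/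
theorem IsClosedConvex.exists_linear_lower_bound {h : Vec N → EReal} (hh : IsClosedConvex h)
    {x : Vec N} (hx : x ∈ dom h) :
    ∃ c : ℝ, 0 ≤ c ∧ ∀ y ∈ dom h, re h x - c * ‖y - x‖ - c ≤ re h y := by
  have hmem : x ∈ Metric.closedBall x 1 := Metric.mem_closedBall_self zero_le_one
  obtain ⟨z, hz, hmin⟩ := LowerSemicontinuousOn.exists_isMinOn ⟨x, hmem⟩
    (isCompact_closedBall x 1) (hh.lsc.lowerSemicontinuousOn _)
  have hzd : z ∈ dom h := show h z < ⊤ from lt_of_le_of_lt (hmin hmem) hx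
  have hle : ∀ y ∈ dom h, ‖y - x‖ ≤ 1 → re h z ≤ re h y := by
    intro y hy hn
    have := hmin (show y ∈ Metric.closedBall x 1 by simpa [dist_eq_norm] using hn)
    rw [mem_ofPred_eq, ← hh.coe_re hzd, ← hh.coe_re hy] at this
    exact EReal.coe_le_coe_iff.1 this
  have hc : re h z ≤ re h x := hle x hx (by simp)
  -- The constant is the largest drop of `h` on the unit ball; by convexity along rays the drop
  -- grows at most proportionally outside it.
  refine ⟨re h x - re h z, by linarith, fun y hy => ?_⟩
  rcases le_or_gt ‖y - x‖ 1 with hn | hn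
  · have := hle y hy hn
    nlinarith [norm_nonneg (y - x)]
  · obtain ⟨w, hw, hwn, hwle⟩ := re_radial_le hh.convexOn_re hx hy hn
    have := hle w hw hwn.le
    nlinarith [norm_nonneg (y - x)]

/-- Sublevel sets of a closed convex function with a unique minimizer are compact. -/
theorem IsClosedConvex.isCompact_sublevel {h : Vec N → EReal} (hh : IsClosedConvex h)
    (hopt : ∃! xs : Vec N, IsMinOn h univ xs) (a : ℝ) : IsCompact {x | h x ≤ a} := by
  have hclosed : IsClosed {x | h x ≤ a} := hh.lsc.isClosed_preimage _
  obtain ⟨xs, hmin, huniq⟩ := hopt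
  rcases Set.eq_empty_or_nonempty {x | h x ≤ a} with he | ⟨x1, hx1⟩
  · rw [he]; exact isCompact_empty
  have hxs : xs ∈ dom h := show h xs < ⊤ from
    lt_of_le_of_lt (hmin (mem_univ x1)) (mem_dom_of_le hx1)
  -- Lower semicontinuity attains the minimum on the unit sphere, and uniqueness of the minimizer
  -- makes the excess there positive. Convexity along rays turns it into linear growth with slope
  -- `η`.
  have hη : ∃ η : ℝ, 0 < η ∧ ∀ z ∈ dom h, ‖z - xs‖ = 1 → re h xs + η ≤ re h z := by
    rcases Set.eq_empty_or_nonempty (Metric.sphere xs 1) with he | hne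
    · refine ⟨1, one_pos, fun z _ hz => ?_⟩
      have : z ∈ Metric.sphere xs 1 := by simpa [dist_eq_norm] using hz
      simp [he] at this
    · obtain ⟨w, hw, hwmin⟩ := LowerSemicontinuousOn.exists_isMinOn hne
        (isCompact_sphere xs 1) (hh.lsc.lowerSemicontinuousOn _)
      by_cases hwd : w ∈ dom h
      · refine ⟨re h w - re h xs, ?_, fun z hz hzn => ?_⟩
        · by_contra hle
          have : h w ≤ h xs := by
            rw [← hh.coe_re hxs, ← hh.coe_re hwd]
            exact EReal.coe_le_coe_iff.2 (by linarith)
          have : w = xs := huniq w fun y hy => this.trans (hmin hy)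
          simp [this] at hw
        · have := hwmin (show z ∈ Metric.sphere xs 1 by simpa [dist_eq_norm] using hzn)
          rw [mem_ofPred_eq, ← hh.coe_re hwd, ← hh.coe_re hz, EReal.coe_le_coe_iff] at this
          linarith
      · refine ⟨1, one_pos, fun z hz hzn => absurd (show h w < ⊤ from ?_) hwd⟩
        exact lt_of_le_of_lt
          (hwmin (show z ∈ Metric.sphere xs 1 by simpa [dist_eq_norm] using hzn)) hz
  obtain ⟨η, hη0, hη⟩ := hη
  refine Metric.isCompact_of_isClosed_isBounded hclosed ?_
  refine (Metric.isBounded_closedBall (x := xs) (r := max 1 ((a - re h xs) / η))).subset ?_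
  intro y hy
  obtain ⟨hyd, hya⟩ := hh.le_coe_iff.1 hy
  rw [Metric.mem_closedBall, dist_eq_norm]
  rcases le_or_gt ‖y - xs‖ 1 with hn | hn
  · exact hn.trans (le_max_left _ _)
  · refine le_trans ?_ (le_max_right _ _)
    obtain ⟨w, hw, hwn, hwle⟩ := re_radial_le hh.convexOn_re hxs hyd hn
    have := hη w hw hwn
    rw [le_div_iff₀ hη0]
    nlinarith [norm_nonneg (y - xs)]

end Convex

end CompositeSC

namespace CompositeSC

open Set Filter Topology

/-! ### Derivatives of self-concordant functions -/

section SelfConcordant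

variable {N : ℕ} {M : ℝ} {f g : Vec N → EReal}

/-- The first derivative of the real part. -/
noncomputable def D1 (f : Vec N → EReal) (x : Vec N) : Vec N →L[ℝ] ℝ := fderiv ℝ (re f) x

/-- The second derivative of the real part. -/
noncomputable def D2 (f : Vec N → EReal) (x : Vec N) : Vec N →L[ℝ] Vec N →L[ℝ] ℝ :=
  fderiv ℝ (D1 f) x

/-- The third derivative of the real part. -/
noncomputable def D3 (f : Vec N → EReal) (x : Vec N) : Vec N →L[ℝ] Vec N →L[ℝ] Vec N →L[ℝ] ℝ :=
  fderiv ℝ (D2 f) x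

namespace IsSelfConcordant

theorem contDiffAt_re (hf : IsSelfConcordant M f) {x : Vec N} (hx : x ∈ dom f) :
    ContDiffAt ℝ 3 (re f) x :=
  hf.contDiffOn.contDiffAt (hf.isOpen_dom.mem_nhds hx)

theorem contDiffAt_D1 (hf : IsSelfConcordant M f) {x : Vec N} (hx : x ∈ dom f) :
    ContDiffAt ℝ 2 (D1 f) x :=
  (hf.contDiffAt_re hx).fderiv_right (by norm_num)

theorem contDiffAt_D2 (hf : IsSelfConcordant M f) {x : Vec N} (hx : x ∈ dom f) :
    ContDiffAt ℝ 1 (D2 f) x :=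
  (hf.contDiffAt_D1 hx).fderiv_right (by norm_num)

theorem hasFDerivAt_re (hf : IsSelfConcordant M f) {x : Vec N} (hx : x ∈ dom f) :
    HasFDerivAt (re f) (D1 f x) x :=
  ((hf.contDiffAt_re hx).differentiableAt (by norm_num)).hasFDerivAt

theorem hasFDerivAt_D1 (hf : IsSelfConcordant M f) {x : Vec N} (hx : x ∈ dom f) :
    HasFDerivAt (D1 f) (D2 f x) x :=
  ((hf.contDiffAt_D1 hx).differentiableAt (by norm_num)).hasFDerivAt

theorem hasFDerivAt_D2 (hf : IsSelfConcordant M f) {x : Vec N} (hx : x ∈ dom f) :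
    HasFDerivAt (D2 f) (D3 f x) x :=
  ((hf.contDiffAt_D2 hx).differentiableAt (by norm_num)).hasFDerivAt

theorem D2_symm (hf : IsSelfConcordant M f) {x : Vec N} (hx : x ∈ dom f) (u v : Vec N) :
    D2 f x u v = D2 f x v u :=
  ((hf.contDiffAt_re hx).isSymmSndFDerivAt
    (by rw [minSmoothness_of_isRCLikeNormedField]; norm_num)).eq u v

theorem D3_symm_left (hf : IsSelfConcordant M f) {x : Vec N} (hx : x ∈ dom f) (u v w : Vec N) :
    D3 f x u v w = D3 f x v u w :=
  congrArg (fun L : Vec N →L[ℝ] ℝ => L w)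
    (((hf.contDiffAt_D1 hx).isSymmSndFDerivAt (by simp)).eq u v)

theorem hasDerivAt_line (x d : Vec N) (t : ℝ) : HasDerivAt (fun t : ℝ => x + t • d) d t := by
  simpa using ((hasDerivAt_id t).smul_const d).const_add x

theorem hasDerivAt_re_line (hf : IsSelfConcordant M f) {x d : Vec N} {t : ℝ}
    (hx : x + t • d ∈ dom f) :
    HasDerivAt (fun t : ℝ => re f (x + t • d)) (D1 f (x + t • d) d) t :=
  HasFDerivAt.comp_hasDerivAt (l := re f) t (hf.hasFDerivAt_re hx) (hasDerivAt_line x d t)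

theorem hasDerivAt_D1_line (hf : IsSelfConcordant M f) {x d : Vec N} {t : ℝ}
    (hx : x + t • d ∈ dom f) (v : Vec N) :
    HasDerivAt (fun t : ℝ => D1 f (x + t • d) v) (D2 f (x + t • d) d v) t := by
  have h := (hf.hasFDerivAt_D1 hx).comp_hasDerivAt t (hasDerivAt_line x d t)
  exact ((ContinuousLinearMap.apply ℝ ℝ v).hasFDerivAt).comp_hasDerivAt t h

theorem hasDerivAt_D2_line (hf : IsSelfConcordant M f) {x d : Vec N} {t : ℝ}
    (hx : x + t • d ∈ dom f) (u v : Vec N) :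
    HasDerivAt (fun t : ℝ => D2 f (x + t • d) u v) (D3 f (x + t • d) d u v) t := by
  have h := HasFDerivAt.comp_hasDerivAt (l := D2 f) t (hf.hasFDerivAt_D2 hx)
    (hasDerivAt_line x d t)
  have h2 := ((ContinuousLinearMap.apply ℝ (Vec N →L[ℝ] ℝ) u).hasFDerivAt).comp_hasDerivAt t h
  exact ((ContinuousLinearMap.apply ℝ ℝ v).hasFDerivAt).comp_hasDerivAt t h2

theorem eventually_line_mem (hf : IsSelfConcordant M f) {x d : Vec N} {t : ℝ}
    (hx : x + t • d ∈ dom f) : ∀ᶠ s in 𝓝 t, x + s • d ∈ dom f :=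
  (hasDerivAt_line x d t).continuousAt.eventually (hf.isOpen_dom.mem_nhds hx)

/-- The symmetry of `D2` holds at all nearby points of the open domain, so it can be differentiated
along the direction `u`. -/
theorem D3_symm_right (hf : IsSelfConcordant M f) {x : Vec N} (hx : x ∈ dom f) (u v w : Vec N) :
    D3 f x u v w = D3 f x u w v := by
  have hx' : x + (0 : ℝ) • u ∈ dom f := by simpa using hx
  have h1 := hf.hasDerivAt_D2_line hx' v w
  have h2 := hf.hasDerivAt_D2_line hx' w v
  have := h1.unique (h2.congr_of_eventuallyEq
    ((hf.eventually_line_mem hx').mono fun s hs => hf.D2_symm hs v w))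
  simpa using this

theorem iteratedDeriv_two_line (hf : IsSelfConcordant M f) {x u : Vec N} {t : ℝ}
    (hx : x + t • u ∈ dom f) :
    iteratedDeriv 2 (fun t : ℝ => (f (x + t • u)).toReal) t = D2 f (x + t • u) u u := by
  rw [iteratedDeriv_succ, iteratedDeriv_one]
  have : deriv (fun t : ℝ => (f (x + t • u)).toReal) =ᶠ[𝓝 t] fun t => D1 f (x + t • u) u :=
    (hf.eventually_line_mem hx).mono fun s hs => (hf.hasDerivAt_re_line hs).deriv
  rw [this.deriv_eq, (hf.hasDerivAt_D1_line hx u).deriv]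

theorem iteratedDeriv_three_line (hf : IsSelfConcordant M f) {x u : Vec N} {t : ℝ}
    (hx : x + t • u ∈ dom f) :
    iteratedDeriv 3 (fun t : ℝ => (f (x + t • u)).toReal) t = D3 f (x + t • u) u u u := by
  rw [iteratedDeriv_succ]
  have : iteratedDeriv 2 (fun t : ℝ => (f (x + t • u)).toReal) =ᶠ[𝓝 t]
      fun t => D2 f (x + t • u) u u :=
    (hf.eventually_line_mem hx).mono fun s hs => hf.iteratedDeriv_two_line hs
  rw [this.deriv_eq, (hf.hasDerivAt_D2_line hx u u).deriv]

theorem abs_D3_diag_le (hf : IsSelfConcordant M f) {x : Vec N} (hx : x ∈ dom f)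
    {u : Vec N} (hu : 0 ≤ D2 f x u u) : |D3 f x u u u| ≤ M * (D2 f x u u * √(D2 f x u u)) := by
  have hx' : x + (0 : ℝ) • u ∈ dom f := by simpa using hx
  have h := hf.third_le x hx u
  rw [hf.iteratedDeriv_two_line hx', hf.iteratedDeriv_three_line hx', zero_smul, add_zero] at h
  convert h using 2
  rcases hu.eq_or_lt with h0 | h0
  · rw [← h0]; norm_num
  · rw [Real.sqrt_eq_rpow, show (3 / 2 : ℝ) = 1 + 1 / 2 by norm_num, Real.rpow_add h0,
      Real.rpow_one]

theorem inner_grad (x v : Vec N) : inner ℝ (grad f x) v = D1 f x v :=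
  InnerProductSpace.toDual_symm_apply

theorem differentiableAt_grad (hf : IsSelfConcordant M f) {x : Vec N} (hx : x ∈ dom f) :
    DifferentiableAt ℝ (grad f) x := by
  rw [differentiableAt_euclidean]
  intro i
  have h : (fun y => grad f y i) = fun y => D1 f y (EuclideanSpace.single i 1) := by
    funext y
    rw [← inner_grad]
    simp [EuclideanSpace.inner_single_right]
  rw [h]
  exact ((ContinuousLinearMap.apply ℝ ℝ _).differentiableAt).comp x
    (hf.hasFDerivAt_D1 hx).differentiableAt

theorem inner_hess (hf : IsSelfConcordant M f) {x : Vec N} (hx : x ∈ dom f) (u v : Vec N) :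
    inner ℝ u (hess f x v) = D2 f x v u := by
  have h1 := ((innerSL ℝ u).hasFDerivAt).comp x (hf.differentiableAt_grad hx).hasFDerivAt
  have h2 := ((ContinuousLinearMap.apply ℝ ℝ u).hasFDerivAt).comp x (hf.hasFDerivAt_D1 hx)
  have e : (innerSL ℝ u) ∘ grad f = (ContinuousLinearMap.apply ℝ ℝ u) ∘ D1 f := by
    funext y
    simp only [Function.comp_apply, innerSL_apply_apply, ContinuousLinearMap.apply_apply]
    rw [real_inner_comm, inner_grad]
  rw [e] at h1
  exact congrArg (fun L : Vec N →L[ℝ] ℝ => L v) (h1.unique h2)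

theorem localNorm_eq (hf : IsSelfConcordant M f) {x : Vec N} (hx : x ∈ dom f) (u : Vec N) :
    localNorm f x u = √(D2 f x u u) := by
  rw [localNorm, hf.inner_hess hx]

end IsSelfConcordant

/-! ### The composite problem -/

/-- The standing assumptions on the composite function `f + g`. -/
structure IsComposite (f g : Vec N → EReal) : Prop where
  sc : IsStandardSelfConcordant f
  cc : IsClosedConvex g
  pos : ∀ x ∈ dom (f + g), ∀ u : Vec N, u ≠ 0 → 0 < inner ℝ u (hess f x u)

namespace IsComposite

theorem scf (h : IsComposite f g) : IsSelfConcordant 2 f := h.sc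

theorem ccf (h : IsComposite f g) : IsClosedConvex f := h.scf.toIsClosedConvex

theorem mem_dom (h : IsComposite f g) {x : Vec N} : x ∈ dom (f + g) ↔ x ∈ dom f ∧ x ∈ dom g :=
  h.ccf.mem_dom_add h.cc

theorem D2_pos (h : IsComposite f g) {x : Vec N} (hx : x ∈ dom f) (hxg : x ∈ dom g) (u : Vec N)
    (hu : u ≠ 0) : 0 < D2 f x u u := by
  rw [← h.scf.inner_hess hx]
  exact h.pos x (h.mem_dom.2 ⟨hx, hxg⟩) u hu

theorem D2_nonneg (h : IsComposite f g) {x : Vec N} (hx : x ∈ dom f) (hxg : x ∈ dom g)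
    (u : Vec N) : 0 ≤ D2 f x u u := by
  by_cases hu : u = 0
  · simp [hu]
  · exact (h.D2_pos hx hxg u hu).le

theorem sq_localNorm (h : IsComposite f g) {x : Vec N} (hx : x ∈ dom f) (hxg : x ∈ dom g)
    (u : Vec N) : localNorm f x u ^ 2 = D2 f x u u := by
  rw [h.scf.localNorm_eq hx, Real.sq_sqrt (h.D2_nonneg hx hxg u)]

theorem localNorm_pos (h : IsComposite f g) {x : Vec N} (hx : x ∈ dom f) (hxg : x ∈ dom g)
    {u : Vec N} (hu : u ≠ 0) : 0 < localNorm f x u := by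
  rw [h.scf.localNorm_eq hx]
  exact Real.sqrt_pos.2 (h.D2_pos hx hxg u hu)

theorem abs_D3_le (h : IsComposite f g) {x : Vec N} (hx : x ∈ dom f) (hxg : x ∈ dom g)
    (u v : Vec N) : |D3 f x u u v| ≤ 2 * D2 f x u u * √(D2 f x v v) := by
  refine abs_trilinear_le (h.scf.D2_symm hx) (h.D2_pos hx hxg) (h.scf.D3_symm_left hx)
    (h.scf.D3_symm_right hx) (fun w => ?_) u v
  rw [mul_assoc]
  exact h.scf.abs_D3_diag_le hx (h.D2_nonneg hx hxg w)

theorem line_mem_dom_g (h : IsComposite f g) {x d : Vec N} (hx : x ∈ dom g) (hd : x + d ∈ dom g)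
    {t : ℝ} (ht : t ∈ Icc (0 : ℝ) 1) : x + t • d ∈ dom g := by
  have e : x + t • d = (1 - t) • x + t • (x + d) := by module
  rw [e]
  exact h.cc.convexOn_re.1 hx hd (by linarith [ht.2]) ht.1 (by ring)

theorem line_mem_dom_f (h : IsComposite f g) {x d : Vec N} (hx : x ∈ dom f) (hd : x + d ∈ dom f)
    {t : ℝ} (ht : t ∈ Icc (0 : ℝ) 1) : x + t • d ∈ dom f := by
  have e : x + t • d = (1 - t) • x + t • (x + d) := by module
  rw [e]
  exact h.ccf.convexOn_re.1 hx hd (by linarith [ht.2]) ht.1 (by ring)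

/-! ### Self-concordant estimates along segments -/

theorem D2_line_le (h : IsComposite f g) {x d : Vec N} (hd0 : d ≠ 0) (hx : x ∈ dom g)
    (hd : x + d ∈ dom g) {T : ℝ} (hT : 0 ≤ T) (hT1 : T ≤ 1)
    (hf : ∀ t ∈ Icc 0 T, x + t • d ∈ dom f) (hr : localNorm f x d * T < 1) :
    D2 f (x + T • d) d d ≤ localNorm f x d ^ 2 / (1 - localNorm f x d * T) ^ 2 := by
  have hg : ∀ t ∈ Icc 0 T, x + t • d ∈ dom g := fun t ht =>
    h.line_mem_dom_g hx hd ⟨ht.1, ht.2.trans hT1⟩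
  have hxf : x ∈ dom f := by simpa using hf 0 ⟨le_rfl, hT⟩
  exact le_div_of_selfConcordant (h := fun t => D2 f (x + t • d) d d) hT
    (fun t ht => h.scf.hasDerivAt_D2_line (hf t ht) d d)
    (fun t ht => h.D2_pos (hf t ht) (hg t ht) d hd0)
    (fun t ht => h.abs_D3_le (hf t ht) (hg t ht) d d) (h.localNorm_pos hxf hx hd0)
    (by simp [h.sq_localNorm hxf hx]) hr

theorem re_line_le (h : IsComposite f g) {x d : Vec N} (hd0 : d ≠ 0) (hx : x ∈ dom g)
    (hd : x + d ∈ dom g) {T : ℝ} (hT : 0 ≤ T) (hT1 : T ≤ 1)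
    (hf : ∀ t ∈ Icc 0 T, x + t • d ∈ dom f) (hr : localNorm f x d * T < 1) :
    re f (x + T • d) ≤ re f x + D1 f x d * T + omegaStar (localNorm f x d * T) := by
  have hg : ∀ t ∈ Icc 0 T, x + t • d ∈ dom g := fun t ht =>
    h.line_mem_dom_g hx hd ⟨ht.1, ht.2.trans hT1⟩
  have hxf : x ∈ dom f := by simpa using hf 0 ⟨le_rfl, hT⟩
  have := le_add_omegaStar_of_selfConcordant (p := fun t => re f (x + t • d))
    (p1 := fun t => D1 f (x + t • d) d) (h := fun t => D2 f (x + t • d) d d) hT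
    (fun t ht => h.scf.hasDerivAt_re_line (hf t ht))
    (fun t ht => h.scf.hasDerivAt_D1_line (hf t ht) d)
    (fun t ht => h.scf.hasDerivAt_D2_line (hf t ht) d d)
    (fun t ht => h.D2_pos (hf t ht) (hg t ht) d hd0)
    (fun t ht => h.abs_D3_le (hf t ht) (hg t ht) d d) (h.localNorm_pos hxf hx hd0)
    (by simp [h.sq_localNorm hxf hx]) hr
  simpa using this

/-- The self-concordant lower bound. -/
theorem add_omega_le_re (h : IsComposite f g) {x y : Vec N} (hx : x ∈ dom (f + g))
    (hy : y ∈ dom (f + g)) :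
    re f x + D1 f x (y - x) + omega (localNorm f x (y - x)) ≤ re f y := by
  rw [h.mem_dom] at hx hy
  by_cases hd0 : y - x = 0
  · rw [sub_eq_zero] at hd0
    simp [hd0, localNorm, omega_zero]
  set d := y - x with hd
  have e : y = x + d := by rw [hd]; abel
  rw [e] at hy ⊢
  have hf : ∀ t ∈ Icc (0 : ℝ) 1, x + t • d ∈ dom f := fun t ht => h.line_mem_dom_f hx.1 hy.1 ht
  have hg : ∀ t ∈ Icc (0 : ℝ) 1, x + t • d ∈ dom g := fun t ht => h.line_mem_dom_g hx.2 hy.2 ht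
  have := add_omega_le_of_selfConcordant (p := fun t => re f (x + t • d))
    (p1 := fun t => D1 f (x + t • d) d) (h := fun t => D2 f (x + t • d) d d) zero_le_one
    (fun t ht => h.scf.hasDerivAt_re_line (hf t ht))
    (fun t ht => h.scf.hasDerivAt_D1_line (hf t ht) d)
    (fun t ht => h.scf.hasDerivAt_D2_line (hf t ht) d d)
    (fun t ht => h.D2_pos (hf t ht) (hg t ht) d hd0)
    (fun t ht => h.abs_D3_le (hf t ht) (hg t ht) d d) (h.localNorm_pos hx.1 hx.2 hd0)
    (by simp [h.sq_localNorm hx.1 hx.2])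
  simpa using this

/-- The open Dikin ellipsoid lies in the domain. -/
theorem dikin (h : IsComposite f g) {x d : Vec N} (hx : x ∈ dom (f + g)) (hd : x + d ∈ dom g)
    (hr : localNorm f x d < 1) : x + d ∈ dom f := by
  rw [h.mem_dom] at hx
  by_cases hd0 : d = 0
  · simpa [hd0] using hx.1
  by_contra hnot
  -- The first exit time `τ = sInf A` is attained since `dom f` is open. Before `τ` the upper
  -- estimate keeps `f` bounded, whereas lower semicontinuity forces `f → ∞` at `τ`.
  set A : Set ℝ := {t ∈ Icc (0 : ℝ) 1 | x + t • d ∉ dom f} with hA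
  have hcont : Continuous fun t : ℝ => x + t • d := by fun_prop
  have hAc : IsClosed A :=
    isClosed_Icc.inter ((h.scf.isOpen_dom.preimage hcont).isClosed_compl)
  have hAne : A.Nonempty := ⟨1, ⟨zero_le_one, le_rfl⟩, by simpa using hnot⟩
  have hAb : BddBelow A := ⟨0, fun t ht => ht.1.1⟩
  obtain ⟨⟨h0, h1⟩, hτ⟩ := hAc.csInf_mem hAne hAb
  set τ := sInf A with hτdef
  have hlt : ∀ t ∈ Ico 0 τ, x + t • d ∈ dom f := by
    intro t ht
    by_contra hc
    exact absurd (csInf_le hAb ⟨⟨ht.1, ht.2.le.trans h1⟩, hc⟩) (not_le.2 ht.2)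
  have hτ0 : 0 < τ := by
    rcases h0.eq_or_lt with he | he
    · rw [← he] at hτ
      simp [hx.1] at hτ
    · exact he
  have hr0 := h.localNorm_pos hx.1 hx.2 hd0
  set r := localNorm f x d with hrdef
  set b := re f x + |D1 f x d| + omegaStar r with hb
  have hbound : ∀ t ∈ Ico 0 τ, f (x + t • d) ≤ b := by
    intro t ht
    have ht1 : t ≤ 1 := ht.2.le.trans h1
    have hrt : r * t ≤ r := by nlinarith [ht.1]
    have hle := h.re_line_le hd0 hx.2 hd ht.1 ht1
      (fun s hs => hlt s ⟨hs.1, hs.2.trans_lt ht.2⟩) (hrt.trans_lt hr)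
    refine h.ccf.le_coe_iff.2 ⟨hlt t ht, hle.trans ?_⟩
    have h2 : omegaStar (r * t) ≤ omegaStar r := omegaStar_strictMonoOn.monotoneOn
      ⟨mul_nonneg hr0.le ht.1, hrt.trans_lt hr⟩ ⟨hr0.le, hr⟩ hrt
    have h3 : D1 f x d * t ≤ |D1 f x d| := by
      calc D1 f x d * t ≤ |D1 f x d| * t := by
            gcongr
            · exact ht.1
            · exact le_abs_self _
        _ ≤ |D1 f x d| * 1 := by gcongr
        _ = _ := mul_one _
    linarith
  have htop : (b : EReal) < f (x + τ • d) := by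
    have : f (x + τ • d) = ⊤ := not_lt_top_iff.1 hτ
    rw [this]; exact EReal.coe_lt_top b
  have hev : ∀ᶠ t in 𝓝[<] τ, (b : EReal) < f (x + t • d) :=
    nhdsWithin_le_nhds (hcont.continuousAt.eventually (h.ccf.lsc (x + τ • d) b htop))
  have hev2 : ∀ᶠ t in 𝓝[<] τ, t ∈ Ico 0 τ := by
    filter_upwards [Ico_mem_nhdsLT hτ0] with t ht using ht
  obtain ⟨t, ht1, ht2⟩ := (hev.and hev2).exists
  exact absurd (hbound t ht2) (not_le.2 ht1)

/-- The self-concordant upper bound. -/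
theorem re_le_add_omegaStar (h : IsComposite f g) {x d : Vec N} (hx : x ∈ dom (f + g))
    (hd : x + d ∈ dom g) (hr : localNorm f x d < 1) :
    re f (x + d) ≤ re f x + D1 f x d + omegaStar (localNorm f x d) := by
  have hdf := h.dikin hx hd hr
  rw [h.mem_dom] at hx
  by_cases hd0 : d = 0
  · simp [hd0, localNorm, omegaStar_zero]
  have := h.re_line_le hd0 hx.2 hd zero_le_one le_rfl
    (fun t ht => h.line_mem_dom_f hx.1 hdf ht) (by simpa using hr)
  simpa using this

/-- The quotient `D²f(x + t d)[u,u] / (1 - r t)²`, with `r = ‖d‖_x`, is nondecreasing: the polarized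
bound on `D³f[u,u,d]` makes the numerator's logarithmic derivative at least `-2r / (1 - r t)`. This
moves norms from intermediate points to the end of the step. -/
theorem D2_line_le_end (h : IsComposite f g) {x d : Vec N} (hd0 : d ≠ 0) (hx : x ∈ dom (f + g))
    (hd : x + d ∈ dom (f + g)) (hr : localNorm f x d < 1) (u : Vec N) {t : ℝ}
    (ht : t ∈ Icc (0 : ℝ) 1) :
    D2 f (x + t • d) u u ≤
      (1 - localNorm f x d * t) ^ 2 / (1 - localNorm f x d) ^ 2 * D2 f (x + d) u u := by
  rw [h.mem_dom] at hx hd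
  have hf : ∀ t ∈ Icc (0 : ℝ) 1, x + t • d ∈ dom f := fun t ht => h.line_mem_dom_f hx.1 hd.1 ht
  have hg : ∀ t ∈ Icc (0 : ℝ) 1, x + t • d ∈ dom g := fun t ht => h.line_mem_dom_g hx.2 hd.2 ht
  have hr0 := h.localNorm_pos hx.1 hx.2 hd0
  have hD := fun (t : ℝ) (ht : t ∈ Icc (0 : ℝ) 1) (hrt : localNorm f x d * t < 1) =>
    h.D2_line_le hd0 hx.2 hd.2 ht.1 ht.2 (fun s hs => hf s ⟨hs.1, hs.2.trans ht.2⟩) hrt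
  set r := localNorm f x d with hrdef
  have hlt : ∀ t ∈ Icc (0 : ℝ) 1, 0 < 1 - r * t := fun t ht => by nlinarith [ht.1, ht.2]
  have hder : ∀ t ∈ Icc (0 : ℝ) 1, HasDerivAt (fun t => D2 f (x + t • d) u u / (1 - r * t) ^ 2)
      ((D3 f (x + t • d) d u u * (1 - r * t) ^ 2
        - D2 f (x + t • d) u u * (2 * (1 - r * t) * -r)) / ((1 - r * t) ^ 2) ^ 2) t := by
    intro t ht
    have h1 : HasDerivAt (fun t : ℝ => r * t) r t := by simpa using (hasDerivAt_id t).const_mul r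
    have h2 : HasDerivAt (fun t : ℝ => (1 - r * t) ^ 2) (2 * (1 - r * t) * -r) t := by
      have := (h1.const_sub 1).pow 2
      exact this.congr_deriv (by simp)
    exact (h.scf.hasDerivAt_D2_line (hf t ht) u u).div h2 (pow_ne_zero 2 (hlt t ht).ne')
  have hmono : MonotoneOn (fun t => D2 f (x + t • d) u u / (1 - r * t) ^ 2) (Icc 0 1) := by
    refine monotoneOn_of_hasDerivWithinAt_nonneg (convex_Icc 0 1)
      (fun s hs => (hder s hs).continuousAt.continuousWithinAt)
      (fun s hs => (hder s (interior_subset hs)).hasDerivWithinAt) ?_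
    intro s hs
    have hs := interior_subset hs
    refine div_nonneg ?_ (by positivity)
    have hp := hlt s hs
    have hk := h.D2_nonneg (hf s hs) (hg s hs) u
    have h3 := (abs_le.1 (h.abs_D3_le (hf s hs) (hg s hs) u d)).1
    rw [h.scf.D3_symm_right (hf s hs), h.scf.D3_symm_left (hf s hs)] at h3
    have h4 : √(D2 f (x + s • d) d d) ≤ r / (1 - r * s) := by
      rw [Real.sqrt_le_left (by positivity), div_pow]
      exact hD s hs (by linarith)
    have h5 : √(D2 f (x + s • d) d d) * (1 - r * s) ≤ r := by
      rwa [le_div_iff₀ hp] at h4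
    have h6 : -(2 * D2 f (x + s • d) u u * r) ≤ D3 f (x + s • d) d u u * (1 - r * s) := by
      have := mul_le_mul_of_nonneg_left h5 (by positivity : 0 ≤ 2 * D2 f (x + s • d) u u)
      nlinarith
    have := mul_le_mul_of_nonneg_right h6 hp.le
    nlinarith
  have hm := hmono ht ⟨zero_le_one, le_rfl⟩ ht.2
  have hp := hlt t ht
  simp only [one_smul, mul_one] at hm
  rw [div_le_iff₀ (by positivity)] at hm
  refine hm.trans (le_of_eq ?_)
  ring

/-- The error of the linearized gradient, in the dual local norm at the new point. -/
theorem abs_gradient_error_le (h : IsComposite f g) {x d : Vec N} (hx : x ∈ dom (f + g))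
    (hd : x + d ∈ dom (f + g)) (hr : localNorm f x d < 1) (u : Vec N) :
    |D1 f (x + d) u - D1 f x u - D2 f x d u| ≤
      (localNorm f x d / (1 - localNorm f x d)) ^ 2 * localNorm f (x + d) u := by
  by_cases hd0 : d = 0
  · simp [hd0, localNorm]
  have hend := fun t (ht : t ∈ Icc (0 : ℝ) 1) => h.D2_line_le_end hd0 hx hd hr u ht
  rw [h.mem_dom] at hx hd
  have hf : ∀ t ∈ Icc (0 : ℝ) 1, x + t • d ∈ dom f := fun t ht => h.line_mem_dom_f hx.1 hd.1 ht
  have hg : ∀ t ∈ Icc (0 : ℝ) 1, x + t • d ∈ dom g := fun t ht => h.line_mem_dom_g hx.2 hd.2 ht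
  have hr0 := h.localNorm_pos hx.1 hx.2 hd0
  have hD := fun (t : ℝ) (ht : t ∈ Icc (0 : ℝ) 1) (hrt : localNorm f x d * t < 1) =>
    h.D2_line_le hd0 hx.2 hd.2 ht.1 ht.2 (fun s hs => hf s ⟨hs.1, hs.2.trans ht.2⟩) hrt
  rw [← h.sq_localNorm hd.1 hd.2] at hend
  have hL : 0 ≤ localNorm f (x + d) u := Real.sqrt_nonneg _
  set L := localNorm f (x + d) u with hLdef
  set r := localNorm f x d with hrdef
  have hr1 : 0 < 1 - r := by linarith
  have hlt : ∀ t ∈ Icc (0 : ℝ) 1, 1 - r ≤ 1 - r * t := fun t ht => by nlinarith [ht.1, ht.2]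
  set K := (r / (1 - r)) ^ 2 * L with hK
  -- The direction `d` contributes `r² / (1 - r t)²` and the transport of `u` to the endpoint
  -- contributes `(1 - r t) / (1 - r)`. Bounding the remaining `1 / (1 - r t)` by `1 / (1 - r)`
  -- leaves a constant, so the comparison function is `K t²`.
  have hthird : ∀ t ∈ Icc (0 : ℝ) 1, |D3 f (x + t • d) d d u| ≤ 2 * K := by
    intro t ht
    have hp : 0 < 1 - r * t := by linarith [hlt t ht]
    have h1 : √(D2 f (x + t • d) u u) ≤ (1 - r * t) / (1 - r) * L := by
      rw [Real.sqrt_le_left (by positivity), mul_pow, div_pow]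
      exact hend t ht
    calc |D3 f (x + t • d) d d u| ≤ 2 * D2 f (x + t • d) d d * √(D2 f (x + t • d) u u) :=
          h.abs_D3_le (hf t ht) (hg t ht) d u
      _ ≤ 2 * (r ^ 2 / (1 - r * t) ^ 2) * ((1 - r * t) / (1 - r) * L) := by
          gcongr
          exact hD t ht (by linarith)
      _ = 2 * (r ^ 2 / ((1 - r * t) * (1 - r)) * L) := by field_simp
      _ ≤ 2 * (r ^ 2 / ((1 - r) * (1 - r)) * L) := by
          gcongr
          linarith [hlt t ht]
      _ = 2 * K := by rw [hK, div_pow, sq (1 - r)]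
  have hq : ∀ t ∈ Icc (0 : ℝ) 1,
      HasDerivAt (fun t => D1 f (x + t • d) u - D1 f x u - t * D2 f x d u)
        (D2 f (x + t • d) d u - D2 f x d u) t := fun t ht => by
    have := ((h.scf.hasDerivAt_D1_line (hf t ht) u).sub_const (D1 f x u)).sub
      ((hasDerivAt_id t).mul_const (D2 f x d u))
    exact this.congr_deriv (by simp)
  have hq1 : ∀ t ∈ Icc (0 : ℝ) 1,
      HasDerivAt (fun t => D2 f (x + t • d) d u - D2 f x d u) (D3 f (x + t • d) d d u) t :=
    fun t ht => (h.scf.hasDerivAt_D2_line (hf t ht) d u).sub_const _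
  have hb : ∀ t ∈ Icc (0 : ℝ) 1, HasDerivAt (fun t : ℝ => K * t ^ 2) (2 * K * t) t := fun t _ => by
    have := ((hasDerivAt_id t).pow 2).const_mul K
    exact this.congr_deriv (by simp; ring)
  have hb1 : ∀ t ∈ Icc (0 : ℝ) 1, HasDerivAt (fun t : ℝ => 2 * K * t) (2 * K) t := fun t _ => by
    simpa using (hasDerivAt_id t).const_mul (2 * K)
  have up := le_of_second_deriv_le zero_le_one hq hq1 hb hb1 (by simp) (by simp)
    (fun t ht => (abs_le.1 (hthird t ht)).2)
  have lo := le_of_second_deriv_le zero_le_one (fun t ht => (hb t ht).neg)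
    (fun t ht => (hb1 t ht).neg) hq hq1 (by simp) (by simp)
    (fun t ht => (abs_le.1 (hthird t ht)).1)
  simp only [one_smul, one_mul, one_pow, mul_one] at up
  simp only [one_smul, one_mul, one_pow, mul_one, Pi.neg_apply] at lo
  exact abs_le.2 ⟨lo, up⟩

end IsComposite

end SelfConcordant

end CompositeSC

namespace CompositeSC

open Set Filter Topology

section ProxNewton

variable {N : ℕ} {f g : Vec N → EReal}

namespace IsComposite

/-! ### The proximal Newton direction -/

/-- The Hessian is uniformly positive definite on compact subsets of the domain. -/
theorem exists_pos_mul_sq_le_D2 (h : IsComposite f g) {K : Set (Vec N)} (hK : IsCompact K)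
    (hKd : K ⊆ dom (f + g)) :
    ∃ μ : ℝ, 0 < μ ∧ ∀ x ∈ K, ∀ u : Vec N, μ * ‖u‖ ^ 2 ≤ D2 f x u u := by
  have hunit : ∃ μ : ℝ, 0 < μ ∧ ∀ x ∈ K, ∀ u : Vec N, ‖u‖ = 1 → μ ≤ D2 f x u u := by
    rcases Set.eq_empty_or_nonempty (K ×ˢ Metric.sphere (0 : Vec N) 1) with he | hne
    · refine ⟨1, one_pos, fun x hx u hu => ?_⟩
      have : (x, u) ∈ K ×ˢ Metric.sphere (0 : Vec N) 1 := ⟨hx, by simpa using hu⟩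
      simp [he] at this
    · have hcont : ContinuousOn (fun p : Vec N × Vec N => D2 f p.1 p.2 p.2)
          (K ×ˢ Metric.sphere (0 : Vec N) 1) := by
        have h1 : ContinuousOn (fun p : Vec N × Vec N => D2 f p.1)
            (K ×ˢ Metric.sphere (0 : Vec N) 1) := by
          refine ContinuousOn.comp (t := K) (fun x hx => ?_) continuousOn_fst (fun p hp => hp.1)
          exact (h.scf.contDiffAt_D2 (h.mem_dom.1 (hKd hx)).1).continuousAt.continuousWithinAt
        exact (h1.clm_apply continuousOn_snd).clm_apply continuousOn_snd
      obtain ⟨p, hp, hmin⟩ := (hK.prod (isCompact_sphere (0 : Vec N) 1)).exists_isMinOn hne hcont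
      have hpd := h.mem_dom.1 (hKd hp.1)
      refine ⟨D2 f p.1 p.2 p.2, h.D2_pos hpd.1 hpd.2 _ ?_, fun x hx u hu => ?_⟩
      · intro h0
        have := hp.2
        simp [h0] at this
      · exact hmin (show (x, u) ∈ K ×ˢ Metric.sphere (0 : Vec N) 1 from ⟨hx, by simpa using hu⟩)
  obtain ⟨μ, hμ, hle⟩ := hunit
  refine ⟨μ, hμ, fun x hx u => ?_⟩
  by_cases hu : u = 0
  · simp [hu]
  have hn : 0 < ‖u‖ := norm_pos_iff.2 hu
  have := hle x hx (‖u‖⁻¹ • u) (by rw [norm_smul, norm_inv, norm_norm, inv_mul_cancel₀ hn.ne'])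
  simp only [map_smul, smul_apply, smul_eq_mul] at this
  calc μ * ‖u‖ ^ 2 ≤ (‖u‖⁻¹ * (‖u‖⁻¹ * D2 f x u u)) * ‖u‖ ^ 2 := by gcongr
    _ = D2 f x u u := by field_simp

theorem model_eq (h : IsComposite f g) {x : Vec N} (hx : x ∈ dom (f + g)) (d : Vec N) :
    model f g x d
      = ((re f x + (D1 f x d + 1 / 2 * D2 f x d d) : ℝ) : EReal) + g (x + d) := by
  have hxf := (h.mem_dom.1 hx).1
  rw [model, IsSelfConcordant.inner_grad, h.scf.inner_hess hxf, EReal.coe_add (re f x),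
    h.ccf.coe_re hxf]

/-- The positive definite quadratic dominates the at most linear decrease of `g`, so the model is
coercive as well as lower semicontinuous. -/
theorem exists_isProxNewtonDir (h : IsComposite f g) {x : Vec N} (hx : x ∈ dom (f + g)) :
    ∃ d, IsProxNewtonDir f g x d := by
  obtain ⟨hxf, hxg⟩ := h.mem_dom.1 hx
  obtain ⟨c, hc0, hc⟩ := h.cc.exists_linear_lower_bound hxg
  obtain ⟨μ, hμ, hμle⟩ := h.exists_pos_mul_sq_le_D2 (K := {x}) isCompact_singleton
    (by simpa using hx)
  have hlsc : LowerSemicontinuous (model f g x) := by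
    have e : model f g x = (fun d => ((re f x + (D1 f x d + 1 / 2 * D2 f x d d) : ℝ) : EReal))
        + fun d => g (x + d) := funext fun d => h.model_eq hx d
    rw [e]
    refine lowerSemicontinuous_add_of_ne_bot ?_ ?_ (fun _ => EReal.coe_ne_bot _)
      (fun _ => h.cc.ne_bot _)
    · have : Continuous fun d : Vec N => re f x + (D1 f x d + 1 / 2 * D2 f x d d) := by fun_prop
      exact (continuous_coe_real_ereal.comp this).lowerSemicontinuous
    · exact h.cc.lsc.comp (continuous_const.add continuous_id)
  set a := ‖D1 f x‖ with ha
  -- Once `‖d‖ > 1` the possible loss is at most `a ‖d‖ + c ‖d‖ + c ≤ (a + 2c) ‖d‖`, which `μ ‖d‖² /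
  -- 2` exceeds beyond this radius.
  refine exists_isMinOn_univ_of_coercive hlsc (x := 0) (R := max 1 (2 * (a + 2 * c) / μ)) ?_
  intro d hd
  rw [sub_zero] at hd
  by_cases hdg : x + d ∈ dom g
  · rw [h.model_eq hx, h.model_eq hx, ← h.cc.coe_re hdg, add_zero, ← h.cc.coe_re hxg,
      ← EReal.coe_add, ← EReal.coe_add, EReal.coe_le_coe_iff]
    have h1 := hc _ hdg
    have h2 := hμle x rfl d
    have h3 : -(a * ‖d‖) ≤ D1 f x d := (abs_le.1 ((D1 f x).le_opNorm d)).1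
    have h4 : 1 < ‖d‖ := (le_max_left _ _).trans_lt hd
    have h5 : 2 * (a + 2 * c) < μ * ‖d‖ := by
      have := (le_max_right _ _).trans_lt hd
      rw [div_lt_iff₀ hμ] at this
      linarith
    rw [add_sub_cancel_left] at h1
    simp only [map_zero, mul_zero, add_zero]
    nlinarith
  · have : g (x + d) = ⊤ := not_lt_top_iff.1 hdg
    rw [h.model_eq hx d, this, EReal.coe_add_top]
    exact le_top

theorem isProxNewtonDir_proxDir (h : IsComposite f g) {x : Vec N} (hx : x ∈ dom (f + g)) :
    IsProxNewtonDir f g x (proxDir f g x) :=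
  Classical.epsilon_spec (h.exists_isProxNewtonDir hx)

theorem add_mem_dom_of_isProxNewtonDir (h : IsComposite f g) {x d : Vec N}
    (hx : x ∈ dom (f + g)) (hd : IsProxNewtonDir f g x d) : x + d ∈ dom g := by
  by_contra hc
  have htop : g (x + d) = ⊤ := not_lt_top_iff.1 hc
  have h1 : model f g x d ≤ model f g x 0 := hd (mem_univ 0)
  rw [h.model_eq hx, h.model_eq hx, htop, EReal.coe_add_top, add_zero,
    ← h.cc.coe_re (h.mem_dom.1 hx).2, ← EReal.coe_add] at h1
  exact absurd h1 (not_le.2 (EReal.coe_lt_top _))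

/-- First-order optimality of the proximal Newton direction. -/
theorem proxNewtonDir_optimality (h : IsComposite f g) {x d : Vec N} (hx : x ∈ dom (f + g))
    (hd : IsProxNewtonDir f g x d) {y : Vec N} (hy : y ∈ dom g) :
    0 ≤ D1 f x (y - (x + d)) + D2 f x d (y - (x + d)) + (re g y - re g (x + d)) := by
  have hxf := (h.mem_dom.1 hx).1
  have hdg := h.add_mem_dom_of_isProxNewtonDir hx hd
  have hsub : HasFDerivAt (fun y : Vec N => y - x) (ContinuousLinearMap.id ℝ (Vec N)) (x + d) :=
    (hasFDerivAt_id _).sub_const x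
  have hlin := (D1 f x).hasFDerivAt.comp (x + d) hsub
  have hquad := (((D2 f x).hasFDerivAt.comp (x + d) hsub).clm_apply hsub).const_mul (1 / 2)
  have hq := hlin.add hquad
  have := first_order_of_isLocalMin_add h.cc.convexOn_re hdg hq
    (Eventually.of_forall fun z hz => ?_) hy
  · simp only [add_apply, smul_apply, ContinuousLinearMap.comp_apply, Function.comp_apply,
      ContinuousLinearMap.id_apply, add_sub_cancel_left, ContinuousLinearMap.flip_apply,
      smul_eq_mul, h.scf.D2_symm hxf (y - (x + d)) d] at this
    linarith
  · have h1 : model f g x d ≤ model f g x (z - x) := hd (mem_univ _)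
    rw [h.model_eq hx, h.model_eq hx, add_sub_cancel, ← h.cc.coe_re hz, ← h.cc.coe_re hdg,
      ← EReal.coe_add, ← EReal.coe_add, EReal.coe_le_coe_iff] at h1
    simp only [Pi.add_apply, Function.comp_apply, add_sub_cancel_left]
    linarith

/-- The point `x` minimizes `f - ⟨s, ·⟩ + g` locally, and local minimality suffices. The inequality
therefore holds even for `y` outside `dom f`, as is needed for `y = x + d`, where `d` is a proximal
Newton direction that may leave `dom f`. -/
theorem subdiff_optimality (h : IsComposite f g) {x s : Vec N} (hx : x ∈ dom (f + g))
    (hs : s ∈ subdiff (f + g) x) {y : Vec N} (hy : y ∈ dom g) :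
    0 ≤ D1 f x (y - x) - inner ℝ s (y - x) + (re g y - re g x) := by
  obtain ⟨hxf, hxg⟩ := h.mem_dom.1 hx
  have hq := (h.scf.hasFDerivAt_re hxf).sub ((innerSL ℝ s).hasFDerivAt (x := x))
  have := first_order_of_isLocalMin_add h.cc.convexOn_re hxg hq ?_ hy
  · simpa using this
  · filter_upwards [h.scf.isOpen_dom.mem_nhds hxf] with z hzf hzg
    have hz := h.mem_dom.2 ⟨hzf, hzg⟩
    have h1 := hs z
    rw [h.ccf.add_coe h.cc hx, h.ccf.add_coe h.cc hz, ← EReal.coe_add, EReal.coe_le_coe_iff,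
      inner_sub_right] at h1
    simp only [Pi.sub_apply, innerSL_apply_apply]
    linarith

/-- The proximal Newton decrement is bounded by the dual norm of any subgradient of `f + g`. -/
theorem localNorm_le_of_subgradient (h : IsComposite f g) {x d : Vec N} (hx : x ∈ dom (f + g))
    (hd : IsProxNewtonDir f g x d) {S : Vec N → ℝ} {K : ℝ} (hK0 : 0 ≤ K)
    (hS : 0 ≤ D1 f x d - S d + (re g (x + d) - re g x))
    (hK : |S d| ≤ K * localNorm f x d) : localNorm f x d ≤ K := by
  obtain ⟨hxf, hxg⟩ := h.mem_dom.1 hx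
  have h1 := h.proxNewtonDir_optimality hx hd hxg
  have e : x - (x + d) = -d := by abel
  rw [e, map_neg, map_neg] at h1
  have h2 := h.sq_localNorm hxf hxg d
  have h3 := (abs_le.1 hK).1
  have h4 : 0 ≤ localNorm f x d := Real.sqrt_nonneg _
  -- Adding the optimality condition tested at `x` to `hS` gives `‖d‖_x² ≤ -S d ≤ K ‖d‖_x`.
  by_contra hc
  nlinarith

/-- Quadratic convergence of the full step. -/
theorem full_step (h : IsComposite f g) {x d d' : Vec N} (hx : x ∈ dom (f + g))
    (hd : IsProxNewtonDir f g x d) (hr : localNorm f x d < 1) :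
    x + d ∈ dom (f + g) ∧ (IsProxNewtonDir f g (x + d) d' →
      localNorm f (x + d) d' ≤ (localNorm f x d / (1 - localNorm f x d)) ^ 2) := by
  have hdg := h.add_mem_dom_of_isProxNewtonDir hx hd
  have hxd : x + d ∈ dom (f + g) := h.mem_dom.2 ⟨h.dikin hx hdg hr, hdg⟩
  refine ⟨hxd, fun hd' => ?_⟩
  have hdg' := h.add_mem_dom_of_isProxNewtonDir hxd hd'
  refine h.localNorm_le_of_subgradient hxd hd'
    (S := fun u => D1 f (x + d) u - D1 f x u - D2 f x d u) (sq_nonneg _) ?_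
    (h.abs_gradient_error_le hx hxd hr d')
  have := h.proxNewtonDir_optimality hx hd hdg'
  rw [add_sub_cancel_left] at this
  linarith

/-- The decrease of the objective along a damped step. -/
theorem damped_step (h : IsComposite f g) {x d : Vec N} (hx : x ∈ dom (f + g))
    (hd : IsProxNewtonDir f g x d) :
    x + (1 / (1 + localNorm f x d)) • d ∈ dom (f + g) ∧
      re (f + g) (x + (1 / (1 + localNorm f x d)) • d)
        ≤ re (f + g) x - omega (localNorm f x d) := by
  obtain ⟨hxf, hxg⟩ := h.mem_dom.1 hx
  have hdg := h.add_mem_dom_of_isProxNewtonDir hx hd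
  have hl0 : 0 ≤ localNorm f x d := Real.sqrt_nonneg _
  have hsq := h.sq_localNorm hxf hxg d
  set l := localNorm f x d with hl
  -- This step length minimizes the upper estimate `-α l² + ω_*(α l)`, whose minimum is `-ω(l)`.
  set α := 1 / (1 + l) with hα
  have hα0 : 0 ≤ α := by positivity
  have hα1 : α ≤ 1 := by rw [hα, div_le_one (by positivity)]; linarith
  have hyg : x + α • d ∈ dom g := h.line_mem_dom_g hxg hdg ⟨hα0, hα1⟩
  have hnorm : localNorm f x (α • d) = l / (1 + l) := by
    rw [h.scf.localNorm_eq hxf, map_smul, map_smul, smul_apply, smul_eq_mul, smul_eq_mul, ← hsq,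
      show α * (α * l ^ 2) = (α * l) ^ 2 by ring, Real.sqrt_sq (by positivity), hα]
    ring
  have hlt : l / (1 + l) < 1 := by rw [div_lt_one (by positivity)]; linarith
  have hy : x + α • d ∈ dom (f + g) :=
    h.mem_dom.2 ⟨h.dikin hx hyg (by rwa [hnorm]), hyg⟩
  refine ⟨hy, ?_⟩
  rw [h.ccf.re_add h.cc hx, h.ccf.re_add h.cc hy]
  have h1 := h.re_le_add_omegaStar hx hyg (by rwa [hnorm])
  rw [hnorm, omegaStar_div_one_add hl0, map_smul, smul_eq_mul] at h1
  have h2 : re g (x + α • d) ≤ (1 - α) * re g x + α * re g (x + d) := by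
    have e : x + α • d = (1 - α) • x + α • (x + d) := by module
    rw [e]
    exact h.cc.convexOn_re.2 hxg hdg (by linarith) hα0 (by ring)
  have h3 := h.proxNewtonDir_optimality hx hd hxg
  have e : x - (x + d) = -d := by abel
  rw [e, map_neg, map_neg, ← hsq] at h3
  have h4 := mul_nonneg hα0 h3
  have h5 : α * l ^ 2 + l / (1 + l) = l := by
    rw [hα]; field_simp; ring
  simp only [omega]
  nlinarith

/-! ### The dual local norm -/

/-- Writing `s = ∇²f(x) w` turns the claim into Cauchy–Schwarz for the Hessian form, proved by the
discriminant. Injectivity in finite dimension ensures that `ContinuousLinearMap.inverse` is a true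
inverse and not its default `0`. -/
theorem abs_inner_le (h : IsComposite f g) {x : Vec N} (hx : x ∈ dom (f + g)) (s u : Vec N) :
    |inner ℝ s u| ≤ dualLocalNorm f x s * localNorm f x u := by
  obtain ⟨hxf, hxg⟩ := h.mem_dom.1 hx
  have hinj : Function.Injective (hess f x : Vec N →ₗ[ℝ] Vec N) := by
    rw [← LinearMap.ker_eq_bot, LinearMap.ker_eq_bot']
    intro u hu
    by_contra hne
    have h1 := h.pos x hx u hne
    have h2 : hess f x u = 0 := hu
    simp [h2] at h1
  set e := (LinearEquiv.ofInjectiveEndo _ hinj).toContinuousLinearEquiv with he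
  have hee : hess f x = (e : Vec N →L[ℝ] Vec N) := by
    ext1 v
    rfl
  set w := e.symm s with hw
  have hs : s = hess f x w := by rw [hee, hw]; simp
  have hdual : dualLocalNorm f x s = √(D2 f x w w) := by
    rw [dualLocalNorm, ← h.scf.inner_hess hxf w w, ← hs]
    congr 1
    rw [real_inner_comm s w]
    congr 1
    rw [hee, ContinuousLinearMap.inverse_equiv]
    rfl
  have hinner : inner ℝ s u = D2 f x w u := by
    rw [real_inner_comm, hs, h.scf.inner_hess hxf]
  rw [hdual, h.scf.localNorm_eq hxf, hinner, ← Real.sqrt_mul (h.D2_nonneg hxf hxg w)]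
  refine Real.abs_le_sqrt ?_
  have hdisc := discrim_le_zero (a := D2 f x u u) (b := 2 * D2 f x w u) (c := D2 f x w w)
    fun t => by
      have := h.D2_nonneg hxf hxg (w + t • u)
      simp only [map_add, map_smul, add_apply, smul_apply, smul_eq_mul,
        h.scf.D2_symm hxf u w] at this
      nlinarith
  rw [discrim] at hdisc
  nlinarith

/-- The optimality gap is bounded by `ω_*` of the dual norm of a subgradient. -/
theorem sub_le_omegaStar (h : IsComposite f g) {x y s : Vec N} (hx : x ∈ dom (f + g))
    (hy : y ∈ dom (f + g)) (hs : s ∈ subdiff (f + g) x) (hs1 : dualLocalNorm f x s < 1) :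
    re (f + g) x - re (f + g) y ≤ omegaStar (dualLocalNorm f x s) := by
  rw [h.ccf.re_add h.cc hx, h.ccf.re_add h.cc hy]
  have h1 := h.add_omega_le_re hx hy
  have h2 := h.subdiff_optimality hx hs (h.mem_dom.1 hy).2
  have h3 := (abs_le.1 (h.abs_inner_le hx s (y - x))).1
  have h4 := mul_le_omega_add_omegaStar hs1 (show 0 ≤ localNorm f x (y - x) from Real.sqrt_nonneg _)
  linarith

theorem ofReal_proxLambda_le_lambdaBar (h : IsComposite f g) {x : Vec N}
    (hx : x ∈ dom (f + g)) : ENNReal.ofReal (proxLambda f g x) ≤ lambdaBar f g x := by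
  refine le_iInf₂ fun s hs => ENNReal.ofReal_le_ofReal ?_
  have hd := h.isProxNewtonDir_proxDir hx
  have h1 := h.subdiff_optimality hx hs (h.add_mem_dom_of_isProxNewtonDir hx hd)
  rw [add_sub_cancel_left] at h1
  exact h.localNorm_le_of_subgradient hx hd (S := fun u => inner ℝ s u) (Real.sqrt_nonneg _) h1
    (h.abs_inner_le hx s _)

/-- A subgradient of dual norm below `ω_*⁻¹` of the gap would, by `sub_le_omegaStar`, make the gap
smaller than itself. Only lower bounds on `λ̄` are used, so attainment of its infimum plays no role.
-/
theorem ofReal_omegaStarInv_le_lambdaBar (h : IsComposite f g) {x y : Vec N}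
    (hx : x ∈ dom (f + g)) (hy : y ∈ dom (f + g)) (hle : re (f + g) y ≤ re (f + g) x) :
    ENNReal.ofReal (omegaStarInv (re (f + g) x - re (f + g) y)) ≤ lambdaBar f g x := by
  have hδ := sub_nonneg.2 hle
  refine le_iInf₂ fun s hs => ENNReal.ofReal_le_ofReal ?_
  by_contra hc
  rw [not_le] at hc
  have hw := omegaStarInv_mem hδ
  have h0 : 0 ≤ dualLocalNorm f x s := Real.sqrt_nonneg _
  have h1 := h.sub_le_omegaStar hx hy hs (hc.trans hw.2)
  have h2 := omegaStar_strictMonoOn ⟨h0, hc.trans hw.2⟩ hw hc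
  rw [omegaStar_omegaStarInv hδ] at h2
  linarith

end IsComposite

end ProxNewton

end CompositeSC

namespace CompositeSC

open Set Filter Topology

section Complexity

variable {N : ℕ} {f g : Vec N → EReal}

namespace IsComposite

/-! ### The smallest eigenvalue of the Hessian on the level set -/

theorem levelSet_subset_dom {x0 : Vec N} (hx0 : x0 ∈ dom (f + g)) :
    levelSet f g x0 ⊆ dom (f + g) := fun x hx =>
  show (f + g) x < ⊤ from lt_of_le_of_lt (show (f + g) x ≤ (f + g) x0 from hx) hx0

theorem isSymmetric_hess (h : IsComposite f g) {x : Vec N} (hx : x ∈ dom (f + g)) :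
    (hess f x : Vec N →ₗ[ℝ] Vec N).IsSymmetric := fun u v => by
  have hxf := (h.mem_dom.1 hx).1
  have h1 := h.scf.inner_hess hxf u v
  have h2 := h.scf.inner_hess hxf v u
  rw [h.scf.D2_symm hxf, ← h2] at h1
  rw [real_inner_comm]
  exact h1.symm

/-- The bound `μ` keeps the eigenvalue set bounded below, and the infimum of the Rayleigh quotient
is an eigenvalue when the space is nontrivial. Hence the `sInf` in `lambdaMin` is not a default
value. -/
theorem le_lambdaMin (h : IsComposite f g) [Nontrivial (Vec N)] {x : Vec N}
    (hx : x ∈ dom (f + g)) {μ : ℝ} (hμ : ∀ u, μ * ‖u‖ ^ 2 ≤ D2 f x u u) :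
    μ ≤ lambdaMin (hess f x) ∧ ∀ u, lambdaMin (hess f x) * ‖u‖ ^ 2 ≤ D2 f x u u := by
  have hxd := h.mem_dom.1 hx
  have hlb : ∀ ν ∈ {ν : ℝ | Module.End.HasEigenvalue (hess f x : Vec N →ₗ[ℝ] Vec N) ν}, μ ≤ ν := by
    intro ν hν
    obtain ⟨v, hv⟩ := Module.End.HasEigenvalue.exists_hasEigenvector hν
    have h1 : hess f x v = ν • v := hv.apply_eq_smul
    have h2 := hμ v
    rw [← h.scf.inner_hess hxd.1, h1, real_inner_smul_right, real_inner_self_eq_norm_sq] at h2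
    exact le_of_mul_le_mul_right h2 (pow_pos (norm_pos_iff.2 hv.2) 2)
  have heig := (h.isSymmetric_hess hx).hasEigenvalue_iInf_of_finiteDimensional
  refine ⟨le_csInf ⟨_, heig⟩ hlb, fun u => ?_⟩
  by_cases hu : u = 0
  · simp [hu]
  have hle : lambdaMin (hess f x) ≤ _ := csInf_le ⟨μ, hlb⟩ heig
  have hray := ciInf_le (f := fun v : {v : Vec N // v ≠ 0} =>
    RCLike.re (inner ℝ ((hess f x : Vec N →ₗ[ℝ] Vec N) v) (v : Vec N)) / ‖(v : Vec N)‖ ^ 2)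
    ⟨0, by
      rintro _ ⟨v, rfl⟩
      refine div_nonneg ?_ (by positivity)
      change 0 ≤ inner ℝ (hess f x v) (v : Vec N)
      rw [real_inner_comm, h.scf.inner_hess hxd.1]
      exact h.D2_nonneg hxd.1 hxd.2 _⟩ ⟨u, hu⟩
  have h3 := hle.trans hray
  rw [le_div_iff₀ (pow_pos (norm_pos_iff.2 hu) 2)] at h3
  refine h3.trans (le_of_eq ?_)
  change inner ℝ (hess f x u) u = _
  rw [real_inner_comm, h.scf.inner_hess hxd.1]

/-- Uniqueness of the minimizer makes the level set compact, so the Hessian is uniformly positive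
definite there. -/
theorem sigmaF_spec (h : IsComposite f g) [Nontrivial (Vec N)]
    (hopt : ∃! xs : Vec N, IsMinOn (f + g) univ xs) {x0 : Vec N} (hx0 : x0 ∈ dom (f + g)) :
    0 < sigmaF f g x0 ∧
      ∀ x ∈ levelSet f g x0, ∀ u, √(sigmaF f g x0) * ‖u‖ ≤ localNorm f x u := by
  have hsub : levelSet f g x0 ⊆ dom (f + g) := levelSet_subset_dom hx0
  have hcomp : IsCompact (levelSet f g x0) := by
    have := (h.ccf.add h.cc).isCompact_sublevel hopt (re (f + g) x0)
    rwa [(h.ccf.add h.cc).coe_re hx0] at this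
  obtain ⟨μ, hμ, hle⟩ := h.exists_pos_mul_sq_le_D2 hcomp hsub
  have hmin := fun x (hx : x ∈ levelSet f g x0) => h.le_lambdaMin (hsub hx) (hle x hx)
  have hlb : ∀ a ∈ (fun x => lambdaMin (hess f x)) '' levelSet f g x0, μ ≤ a := by
    rintro _ ⟨x, hx, rfl⟩
    exact (hmin x hx).1
  have hne : x0 ∈ levelSet f g x0 := le_refl ((f + g) x0)
  have hσ : 0 < sigmaF f g x0 := hμ.trans_le (le_csInf ⟨_, x0, hne, rfl⟩ hlb)
  refine ⟨hσ, fun x hx u => ?_⟩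
  have hxd := h.mem_dom.1 (hsub hx)
  have h1 : sigmaF f g x0 ≤ lambdaMin (hess f x) := csInf_le ⟨μ, hlb⟩ ⟨x, hx, rfl⟩
  rw [h.scf.localNorm_eq hxd.1]
  refine Real.le_sqrt_of_sq_le ?_
  rw [mul_pow, Real.sq_sqrt hσ.le]
  exact (mul_le_mul_of_nonneg_right h1 (sq_nonneg _)).trans ((hmin x hx).2 u)

/-! ### Linear decrease under the error bound -/

/-- Under the error bound, the damped step contracts the optimality gap. -/
theorem one_sub_contraction_mul_gap_le (h : IsComposite f g) [Nontrivial (Vec N)]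
    (hopt : ∃! xs : Vec N, IsMinOn (f + g) univ xs) {x0 : Vec N} (hx0 : x0 ∈ dom (f + g))
    {c₃ : ℝ} (hc₃ : 0 < c₃) {x y : Vec N} (hx : x ∈ levelSet f g x0)
    (hbound : ENNReal.ofReal c₃ * lambdaBar f g x ≤ ENNReal.ofReal ‖proxDir f g x‖)
    (hy : y ∈ dom (f + g)) (hle : re (f + g) y ≤ re (f + g) x)
    {δ : ℝ} (hδ : re (f + g) x - re (f + g) y ≤ δ) :
    (1 - contraction (c₃ * √(sigmaF f g x0)) δ) * (re (f + g) x - re (f + g) y)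
      ≤ omega (proxLambda f g x) := by
  obtain ⟨hσ, hσle⟩ := h.sigmaF_spec hopt hx0
  have hxd := levelSet_subset_dom hx0 hx
  have h1 := (mul_le_mul_right (h.ofReal_omegaStarInv_le_lambdaBar hxd hy hle)
    (ENNReal.ofReal c₃)).trans hbound
  rw [← ENNReal.ofReal_mul hc₃.le, ENNReal.ofReal_le_ofReal_iff (norm_nonneg _)] at h1
  have hgap := sub_nonneg.2 hle
  set w := omegaStarInv (re (f + g) x - re (f + g) y) with hw
  have hwm : w ∈ Ico (0 : ℝ) 1 := omegaStarInv_mem hgap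
  have hwm0 := omegaStarInv_mem (hgap.trans hδ)
  have hmono : w ≤ omegaStarInv δ := omegaStarInv_mono hgap hδ
  have h2 : c₃ * √(sigmaF f g x0) * w ≤ proxLambda f g x := by
    refine le_trans ?_ (hσle x hx (proxDir f g x))
    have := mul_le_mul_of_nonneg_left h1 (Real.sqrt_nonneg (sigmaF f g x0))
    linarith
  have hc : 0 ≤ c₃ * √(sigmaF f g x0) := by positivity
  have h3 := ratio_mul_omegaStar_le_omega hc hwm.1 hmono hwm0.2
  rw [hw, omegaStar_omegaStarInv hgap, ← hw] at h3
  rw [contraction, sub_sub_cancel]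
  exact h3.trans (omega_strictMonoOn.monotoneOn (mul_nonneg hc hwm.1)
    (mem_Ici.2 (Real.sqrt_nonneg _)) h2)

/-- Since `λ̃ ≤ λ̄`, the error bound gives `c₃ λ̃ ≤ ‖d̃‖`, while `√σ_f ‖d̃‖ ≤ λ̃`. This keeps the
contraction factor nonnegative. -/
theorem errorBound_const_le_one (h : IsComposite f g) [Nontrivial (Vec N)]
    (hopt : ∃! xs : Vec N, IsMinOn (f + g) univ xs) {x0 : Vec N} (hx0 : x0 ∈ dom (f + g))
    {c₃ : ℝ} (hc₃ : 0 < c₃)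
    (hbound : ENNReal.ofReal c₃ * lambdaBar f g x0 ≤ ENNReal.ofReal ‖proxDir f g x0‖)
    (hl : 0 < proxLambda f g x0) : c₃ * √(sigmaF f g x0) ≤ 1 := by
  obtain ⟨hσ, hσle⟩ := h.sigmaF_spec hopt hx0
  have h1 := (mul_le_mul_right (h.ofReal_proxLambda_le_lambdaBar hx0)
    (ENNReal.ofReal c₃)).trans hbound
  rw [← ENNReal.ofReal_mul hc₃.le, ENNReal.ofReal_le_ofReal_iff (norm_nonneg _)] at h1
  have h2 : √(sigmaF f g x0) * ‖proxDir f g x0‖ ≤ proxLambda f g x0 :=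
    hσle x0 (le_refl ((f + g) x0)) _
  have h3 := mul_le_mul_of_nonneg_left h1 (Real.sqrt_nonneg (sigmaF f g x0))
  refine le_of_mul_le_mul_right (a := proxLambda f g x0) ?_ hl
  linarith

end IsComposite

theorem contraction_mem_Ioo {c δ : ℝ} (hc0 : 0 < c) (hc1 : c ≤ 1) (hδ : 0 < δ) :
    contraction c δ ∈ Ioo (0 : ℝ) 1 := by
  obtain ⟨h0, h1⟩ := omegaStarInv_mem hδ.le
  have hne : omegaStarInv δ ≠ 0 := fun h => by
    have := omegaStar_omegaStarInv hδ.le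
    rw [h, omegaStar_zero] at this
    exact hδ.ne this
  have hpos : 0 < omegaStarInv δ := lt_of_le_of_ne h0 hne.symm
  have hden : 0 < 1 + c * omegaStarInv δ := by positivity
  have hnum : 0 < 1 - omegaStarInv δ := by linarith
  rw [contraction, mem_Ioo, sub_pos, div_lt_one hden]
  refine ⟨?_, by linarith [div_pos (mul_pos (pow_pos hc0 2) hnum) hden]⟩
  have : c ^ 2 ≤ 1 := pow_le_one₀ hc0.le hc1
  nlinarith [mul_pos hc0 hpos]

theorem pow_mul_le_of_log_ratio_le {r a δ : ℝ} (hr : r ∈ Ioo (0 : ℝ) 1) (ha : 0 < a) (hδ : 0 < δ)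
    {n : ℕ} (hn : (Real.log a - Real.log δ) / Real.log r ≤ n) : r ^ n * δ ≤ a := by
  have hlog : Real.log r < 0 := Real.log_neg hr.1 hr.2
  rw [div_le_iff_of_neg hlog] at hn
  rw [← Real.log_le_log_iff (mul_pos (pow_pos hr.1 n) hδ) ha,
    Real.log_mul (pow_pos hr.1 n).ne' hδ.ne', Real.log_pow]
  linarith

/-! ### The two phases of the method -/

theorem gap_eq_of_isMinOn {xs : Vec N} (hmin : IsMinOn (f + g) univ xs)
    (x0 : Vec N) : gap f g x0 = re (f + g) x0 - re (f + g) xs := by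
  have : (⨅ x, (f + g) x) = (f + g) xs :=
    le_antisymm (iInf_le _ xs) (le_iInf fun y => hmin (mem_univ y))
  rw [gap, this, re, re]

theorem IsComposite.re_min_le (h : IsComposite f g) {xs : Vec N}
    (hmin : IsMinOn (f + g) univ xs) {y : Vec N} (hy : y ∈ dom (f + g)) :
    xs ∈ dom (f + g) ∧ re (f + g) xs ≤ re (f + g) y := by
  have h1 : (f + g) xs ≤ (f + g) y := hmin (mem_univ y)
  rw [← (h.ccf.add h.cc).coe_re hy] at h1
  exact (h.ccf.add h.cc).le_coe_iff.1 h1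

/-- The first phase: bounds on the objective while all decrements exceed `0.2`. -/
theorem IsProxNewtonRun.damped_phase {x0 : Vec N} {x : ℕ → Vec N}
    (hx : IsProxNewtonRun f g x0 x) (h : IsComposite f g) (hx0 : x0 ∈ dom (f + g)) {k : ℕ}
    (hk : ∀ j < k, 0.2 < proxLambda f g (x j)) :
    x k ∈ dom (f + g) ∧ re (f + g) (x k) ≤ re (f + g) x0 - k * omega 0.2 := by
  induction k with
  | zero => simpa [hx.init] using hx0
  | succ k ih =>
    obtain ⟨hd, hv⟩ := ih fun j hj => hk j (hj.trans k.lt_succ_self)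
    have hs := h.damped_step hd (h.isProxNewtonDir_proxDir hd)
    rw [hx.damped_step k fun j hj => hk j (Nat.lt_succ_of_le hj)]
    refine ⟨hs.1, hs.2.trans ?_⟩
    have hl := hk k k.lt_succ_self
    have : omega 0.2 ≤ omega (proxLambda f g (x k)) := omega_strictMonoOn.monotoneOn
      (mem_Ici.2 (by norm_num)) (mem_Ici.2 (Real.sqrt_nonneg _)) hl.le
    change re (f + g) (x k) - omega (proxLambda f g (x k)) ≤ _
    push_cast
    linarith

/-- The iterates stay in the level set, where the error bound applies, and their gaps never exceed
`δ`. The factor computed from the initial gap is thus valid at every step. -/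
theorem IsProxNewtonRun.damped_phase_contraction {x0 : Vec N} {x : ℕ → Vec N}
    (hx : IsProxNewtonRun f g x0 x) (h : IsComposite f g) [Nontrivial (Vec N)]
    (hopt : ∃! xs : Vec N, IsMinOn (f + g) univ xs) (hx0 : x0 ∈ dom (f + g)) {c₃ : ℝ}
    (hc₃ : 0 < c₃)
    (hbound : ∀ y ∈ levelSet f g x0,
      ENNReal.ofReal c₃ * lambdaBar f g y ≤ ENNReal.ofReal ‖proxDir f g y‖)
    {xs : Vec N} (hmin : IsMinOn (f + g) univ xs) {δ : ℝ}
    (hδ : re (f + g) x0 - re (f + g) xs = δ)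
    (hr : 0 ≤ contraction (c₃ * √(sigmaF f g x0)) δ) {k : ℕ}
    (hk : ∀ j < k, 0.2 < proxLambda f g (x j)) :
    re (f + g) (x k) - re (f + g) xs ≤ contraction (c₃ * √(sigmaF f g x0)) δ ^ k * δ := by
  induction k with
  | zero => simp [hx.init, hδ]
  | succ k ih =>
    have hk' : ∀ j < k, 0.2 < proxLambda f g (x j) := fun j hj => hk j (hj.trans k.lt_succ_self)
    have hv := ih hk'
    obtain ⟨hd, hdec⟩ := hx.damped_phase h hx0 hk'
    have hω : 0 ≤ (k : ℝ) * omega 0.2 :=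
      mul_nonneg k.cast_nonneg (omega_nonneg (by norm_num))
    have hlev : x k ∈ levelSet f g x0 := by
      change (f + g) (x k) ≤ (f + g) x0
      rw [← (h.ccf.add h.cc).coe_re hd, ← (h.ccf.add h.cc).coe_re hx0, EReal.coe_le_coe_iff]
      linarith
    obtain ⟨hxs, hle⟩ := h.re_min_le hmin hd
    have hc := h.one_sub_contraction_mul_gap_le hopt hx0 hc₃ hlev (hbound _ hlev) hxs hle
      (δ := δ) (by linarith)
    have hs := (h.damped_step hd (h.isProxNewtonDir_proxDir hd)).2
    rw [hx.damped_step k fun j hj => hk j (Nat.lt_succ_of_le hj)]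
    change _ ≤ re (f + g) (x k) - omega (proxLambda f g (x k)) at hs
    have hmul := mul_le_mul_of_nonneg_left hv hr
    rw [pow_succ']
    change re (f + g) (x k + (1 / (1 + localNorm f (x k) (proxDir f g (x k)))) •
      proxDir f g (x k)) - re (f + g) xs ≤ _
    linarith

/-- The length of the first phase. -/
theorem IsProxNewtonRun.exists_proxLambda_le {x0 : Vec N} {x : ℕ → Vec N}
    (hx : IsProxNewtonRun f g x0 x) (h : IsComposite f g)
    (hopt : ∃! xs : Vec N, IsMinOn (f + g) univ xs) (hx0 : x0 ∈ dom (f + g)) {c₃ : ℝ}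
    (hc₃ : 0 < c₃)
    (hbound : ∀ y ∈ levelSet f g x0,
      ENNReal.ofReal c₃ * lambdaBar f g y ≤ ENNReal.ofReal ‖proxDir f g y‖) :
    ∃ k ≤ min ⌈max ((Real.log (omega 0.2) - Real.log (gap f g x0)) /
        Real.log (contraction (c₃ * √(sigmaF f g x0)) (gap f g x0))) 0⌉₊
        ⌈gap f g x0 / omega 0.2⌉₊, proxLambda f g (x k) ≤ 0.2 := by
  obtain ⟨xs, hmin, -⟩ := id hopt
  set n := min ⌈max ((Real.log (omega 0.2) - Real.log (gap f g x0)) /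
        Real.log (contraction (c₃ * √(sigmaF f g x0)) (gap f g x0))) 0⌉₊
        ⌈gap f g x0 / omega 0.2⌉₊ with hn
  by_contra! hc
  have hlt : ∀ j < n, 0.2 < proxLambda f g (x j) := fun j hj => hc j hj.le
  have hω : 0 < omega 0.2 := omega_pos (by norm_num)
  obtain ⟨hd, hdec⟩ := hx.damped_phase h hx0 hlt
  have hgap := gap_eq_of_isMinOn hmin x0
  have hstep := h.damped_step hd (h.isProxNewtonDir_proxDir hd)
  have hlow := (h.re_min_le hmin hstep.1).2
  have hωn : omega 0.2 < omega (localNorm f (x n) (proxDir f g (x n))) := omega_strictMonoOn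
    (mem_Ici.2 (by norm_num)) (mem_Ici.2 (Real.sqrt_nonneg _)) (hc n le_rfl)
  -- The decrement at `x n` itself also exceeds `0.2`, so one further damped step must fit above the
  -- minimum. Both counts contradict this strict inequality.
  have hbig : omega 0.2 < re (f + g) (x n) - re (f + g) xs := by linarith [hstep.2]
  rcases min_choice ⌈max ((Real.log (omega 0.2) - Real.log (gap f g x0)) /
        Real.log (contraction (c₃ * √(sigmaF f g x0)) (gap f g x0))) 0⌉₊
        ⌈gap f g x0 / omega 0.2⌉₊ with hm | hm
  · rw [← hn] at hm
    have hl0 : 0.2 < proxLambda f g x0 := by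
      have := hc 0 (Nat.zero_le _)
      rwa [hx.init] at this
    have hne : proxDir f g x0 ≠ 0 := fun h0 => by
      rw [proxLambda, h0, localNorm] at hl0
      norm_num at hl0
    -- In dimension `0` every decrement vanishes, so that case cannot occur here.
    have : Nontrivial (Vec N) := ⟨_, _, hne⟩
    have hpos : 0 < gap f g x0 := by
      have : 0 ≤ (n : ℝ) * omega 0.2 := by positivity
      linarith
    have hr := contraction_mem_Ioo (c := c₃ * √(sigmaF f g x0)) (δ := gap f g x0)
      (mul_pos hc₃ (Real.sqrt_pos.2 (h.sigmaF_spec hopt hx0).1))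
      (h.errorBound_const_le_one hopt hx0 hc₃ (hbound x0 (le_refl ((f + g) x0)))
        (by linarith)) hpos
    have hcon := hx.damped_phase_contraction h hopt hx0 hc₃ hbound hmin hgap.symm hr.1.le hlt
    have hle := (le_max_left _ _).trans (Nat.le_ceil (max ((Real.log (omega 0.2) -
      Real.log (gap f g x0)) / Real.log (contraction (c₃ * √(sigmaF f g x0)) (gap f g x0))) 0))
    rw [← hm] at hle
    exact absurd (pow_mul_le_of_log_ratio_le hr hω hpos hle) (by linarith)
  · rw [← hn] at hm
    have hle := Nat.le_ceil (gap f g x0 / omega 0.2)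
    rw [← hm, div_le_iff₀ hω] at hle
    linarith

/-- The second phase: from a small decrement on, full steps stay in the domain. -/
theorem IsProxNewtonRun.full_phase {x0 : Vec N} {x : ℕ → Vec N}
    (hx : IsProxNewtonRun f g x0 x) (h : IsComposite f g) {K : ℕ} (hK : x K ∈ dom (f + g))
    (hl : proxLambda f g (x K) ≤ 0.2) (m : ℕ) :
    x (K + m) ∈ dom (f + g) ∧ proxLambda f g (x (K + m)) ≤ 0.2 ∧
      proxLambda f g (x (K + (m + 1))) ≤
        (proxLambda f g (x (K + m)) / (1 - proxLambda f g (x (K + m)))) ^ 2 := by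
  have step : ∀ m, x (K + m) ∈ dom (f + g) → proxLambda f g (x (K + m)) ≤ 0.2 →
      x (K + (m + 1)) ∈ dom (f + g) ∧ proxLambda f g (x (K + (m + 1))) ≤
        (proxLambda f g (x (K + m)) / (1 - proxLambda f g (x (K + m)))) ^ 2 := by
    intro m hm hlm
    have hs := h.full_step (d' := proxDir f g (x (K + (m + 1)))) hm (h.isProxNewtonDir_proxDir hm)
      (lt_of_le_of_lt hlm (by norm_num))
    have e : x (K + (m + 1)) = x (K + m) + proxDir f g (x (K + m)) :=
      hx.full_step (K + m) ⟨K, Nat.le_add_right _ _, hl⟩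
    rw [← e] at hs
    exact ⟨hs.1, hs.2 (h.isProxNewtonDir_proxDir hs.1)⟩
  induction m with
  | zero => exact ⟨hK, hl, (step 0 hK hl).2⟩
  | succ m ih =>
    obtain ⟨hd, hlm, hq⟩ := ih
    have hd' := (step m hd hlm).1
    have hl' : proxLambda f g (x (K + (m + 1))) ≤ 0.2 := hq.trans <|
      (div_one_sub_sq_le (Real.sqrt_nonneg _) hlm (by norm_num)).trans (by norm_num)
    exact ⟨hd', hl', (step (m + 1) hd' hl').2⟩

end Complexity

end CompositeSC

/-! ### Joining the two phases -/

theorem mainTheorem9 {N : ℕ} (f g : CompositeSC.Vec N → EReal)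
    (hf : CompositeSC.IsStandardSelfConcordant f)
    (hg : CompositeSC.IsProperClosedConvex g)
    (hpos : ∀ x ∈ CompositeSC.dom (f + g), ∀ u : CompositeSC.Vec N, u ≠ 0 →
      0 < inner ℝ u (CompositeSC.hess f x u))
    (hopt : ∃! xs : CompositeSC.Vec N, IsMinOn (f + g) Set.univ xs)
    (x0 : CompositeSC.Vec N) (hx0 : x0 ∈ CompositeSC.dom (f + g))
    (c₃ : ℝ) (hc₃ : 0 < c₃)
    (hassump : ∀ x ∈ CompositeSC.levelSet f g x0,
      ENNReal.ofReal c₃ * CompositeSC.lambdaBar f g x ≤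
        ENNReal.ofReal ‖CompositeSC.proxDir f g x‖)
    (ε : ℝ) (hε : 0 < ε) (hεsmall : ε < 0.28 * Real.exp (-Real.exp (2 / 3)))
    (x : ℕ → CompositeSC.Vec N) (hx : CompositeSC.IsProxNewtonRun f g x0 x) :
    ∃ k : ℕ,
      k ≤ CompositeSC.iterationBound (c₃ * √(CompositeSC.sigmaF f g x0))
        (CompositeSC.gap f g x0) ε ∧
      (∀ j ≤ k, x j ∈ CompositeSC.dom (f + g) ∧
        CompositeSC.IsProxNewtonDir f g (x j) (CompositeSC.proxDir f g (x j))) ∧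
      CompositeSC.proxLambda f g (x k) ≤ ε := by
  have h : CompositeSC.IsComposite f g := ⟨hf, hg.toIsClosedConvex, hpos⟩
  obtain ⟨k₁, hk₁, hl₁⟩ := hx.exists_proxLambda_le h hopt hx0 hc₃ hassump
  classical
  have hex : ∃ k, CompositeSC.proxLambda f g (x k) ≤ 0.2 := ⟨k₁, hl₁⟩
  -- The method switches at the first small decrement, so `K` must be minimal; the index `k₁` only
  -- bounds it.
  set K := Nat.find hex with hK
  have hlt : ∀ j < K, 0.2 < CompositeSC.proxLambda f g (x j) := fun j hj =>
    not_le.1 (Nat.find_min hex hj)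
  have hdamp : ∀ k ≤ K, x k ∈ CompositeSC.dom (f + g) := fun k hk =>
    (hx.damped_phase h hx0 fun j hj => hlt j (hj.trans_le hk)).1
  have hfull := hx.full_phase h (hdamp K le_rfl) (Nat.find_spec hex)
  refine ⟨K + ⌈1.5 * Real.log (Real.log (0.28 / ε))⌉₊,
    Nat.add_le_add_right ((Nat.find_min' hex hl₁).trans hk₁) _, fun j _ => ?_, ?_⟩
  · have hd : x j ∈ CompositeSC.dom (f + g) := by
      rcases le_total j K with hj | hj
      · exact hdamp j hj
      · obtain ⟨m, rfl⟩ := Nat.exists_eq_add_of_le hj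
        exact (hfull m).1
    exact ⟨hd, h.isProxNewtonDir_proxDir hd⟩
  · exact CompositeSC.quadratic_decay_le (l := fun m => CompositeSC.proxLambda f g (x (K + m)))
      (fun _ => Real.sqrt_nonneg _) (Nat.find_spec hex) (fun m _ => (hfull m).2.2) hε hεsmall
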